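/- **Setting.** Let $G=(V,E)$ be a finite non-empty triangle-free $D$-regular graph, $D\ge 1$. A spin configuration $z\in\{-1,+1\}^V$ cuts the edge $ij$ if $z_i\ne z_j$; $C(z)$ is the number of cut edges and $C(z)/|E|$ the cut fraction. *One-step QAOA.* For angles $\gamma,\beta\in\mathbb R$, measure the state $e^{-i\beta B}e^{-i\gamma C}|+\rangle$ in the computational basis, where $|+\rangle$ is the uniform superposition of all configurations and $B=\sum_{i\in V}X_i$ is the sum of the Pauli $X$ operators. *Local algorithms.* In a one-step local classical algorithm (with finitely many local states) each vertex draws an initial state independently from a common distribution, and then each vertex, independently of the others given the initial states, chooses its spin with a law depending only on its own initial state and those of its neighbours. - *Soft-threshold algorithm* with rule $q:\mathbb N\to[-1,1]$: initial spins are independent and uniform on $\{-1,+1\}$; a vertex with initial spin $s$, exactly $m$ of whose neighbours have the same initial spin, gets a final spin of expectation $q(m)s$ (it flips with probability $(1-q(m))/2$). The *threshold algorithm* with threshold $\tau\in\mathbb N$ has $q(m)=-1$ for $m\ge\tau$ and $q(m)=1$ for $m<\tau$. - *Local tensor algorithm* with parameters: a finitely supported law on $\mathbb R$, a constant $c\in\mathbb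 R$, and a function $g:\mathbb R\to[-1,1]$. The entries of $v_0\in\mathbb R^V$ are drawn independently from the law, $v_1=g(v_0+cJv_0)$ entrywise with $J=-(\text{adjacency matrix})$, and then the spins are chosen independently given $v_1$, the spin of $i$ with expectation $(v_1)_i$. With $g=\operatorname{sign}$ the spin is the sign of $(v_0+cJv_0)_i$, and uniformly random if this is $0$. **Claim.** Put $$Q(D)=\frac12+\frac1{2\sqrt D}\Bigl(1-\frac1D\Bigr)^{(D-1)/2}.$$ Say that an algorithm *beats the QAOA in degree $D$* if its expected cut fraction is larger than $Q(D)$ on every finite non-empty triangle-free $D$-regular graph. 1. For every $D\ge1$ and every such graph, $Q(D)$ is the maximum over $(\gamma,\beta)\in\mathbb R^2$ of the expected cut fraction of the one-step QAOA. 2. For every $D\ge1$, every such graph and every rule $q$, the expected cut fraction of the soft-threshold algorithm equals $$\frac12+\frac14\left[\Bigl(\sum_{n=0}^{D-1}2^{-(D-1)}\binom{D-1}{n}q(n)\Bigr)^2-\Bigl(\sum_{n=0}^{D-1}2^{-(D-1)}\binom{D-1}{n}q(n+1)\Bigr)^2\right].$$ 3. For every $3\le D\le1000$ with $D\notin\{3,4,6,11\}$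 there is a threshold $\tau$, depending only on $D$, for which the threshold algorithm beats the QAOA in degree $D$. For $D\in\{3,4,6,11\}$, for every $\tau$ and every such graph, the expected cut fraction of the threshold algorithm is smaller than $Q(D)$. For $D=2$ it is at most $Q(2)$ for every $\tau$ and every such graph, and some $\tau$ gives $Q(2)$ on every such graph. 4. For $D=6$, the soft-threshold algorithm that never flips if at most $3$ neighbours agree, always flips if at least $5$ agree, and flips with probability $0.35$ if exactly $4$ agree, beats the QAOA. 5. For $D=11$, the soft-threshold algorithm that never flips if at most $6$ neighbours agree, always flips if at least $8$ agree, and flips with probability $0.55$ if exactly $7$ agree, beats the QAOA. 6. For $D=3$ and for $D=4$, the local tensor algorithm with initial law uniform on $\{-1,-\frac13,\frac13,1\}$, $c=0.599$ and $g=\operatorname{sign}$ beats the QAOA. 7. Consequently, for every $3\le D\le1000$ there is a one-step local tensor algorithm that beats the QAOA in degree $D$. -/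

import Mathlib

open scoped BigOperators

universe u

noncomputable section

/-! Spins are elements of `ℤˣ = {1, -1}`; a spin configuration `z : V → ℤˣ` is a cut of the graph. -/

/-- The number of edges of `G` cut by the configuration `z`, i.e. of edges whose two endpoints carry
different spins. -/
def cutSize {V : Type u} [Fintype V] [DecidableEq V] (G : SimpleGraph V) [DecidableRel G.Adj]
    (z : V → ℤˣ) : ℕ :=
  (G.edgeFinset.filter (fun e => ¬ (e.map z).IsDiag)).card

/-- The fraction of the edges of `G` cut by the configuration `z`. -/
def cutFraction {V : Type u} [Fintype V] [DecidableEq V] (G : SimpleGraph V) [DecidableRel G.Adj]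
    (z : V → ℤˣ) : ℝ :=
  (cutSize G z : ℝ) / (G.edgeFinset.card : ℝ)

/-! ### One-step local classical algorithms -/

/-- A one-step local classical algorithm with finitely many local states. Every vertex draws its
initial state independently from the law `prob`; then every vertex, independently of the
others given the initial states, chooses its final spin in `{1, -1}` at random, with expectation
`response s N`, where `s` is its own initial state and `N` the multiset of the initial states of its
neighbours. -/
structure LocalAlgorithm where
  State : Type
  [fintypeState : Fintype State]
  prob : State → ℝ
  prob_nonneg : ∀ s, 0 ≤ prob s
  prob_sum : ∑ s, prob s = 1
  response : State → Multiset State → ℝ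
  response_mem : ∀ s N, response s N ∈ Set.Icc (-1 : ℝ) 1

attribute [instance] LocalAlgorithm.fintypeState

namespace LocalAlgorithm

/-- The expectation of the final spin of the vertex `i`, given the initial states `v`. -/
def spinMean (A : LocalAlgorithm) {V : Type u} [Fintype V] (G : SimpleGraph V)
    [DecidableRel G.Adj] (v : V → A.State) (i : V) : ℝ :=
  A.response (v i) ((G.neighborFinset i).val.map v)

/-- The probability that the algorithm, run on `G`, outputs the configuration `z`. A spin with
expectation `m` takes the value `s = ±1` with probability `(1 + s m) / 2`. -/
def outputProb (A : LocalAlgorithm) {V : Type u} [Fintype V] [DecidableEq V] (G : SimpleGraph V)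
    [DecidableRel G.Adj] (z : V → ℤˣ) : ℝ :=
  ∑ v : V → A.State,
    (∏ i, A.prob (v i)) * ∏ i, (1 + (((z i : ℤˣ) : ℤ) : ℝ) * A.spinMean G v i) / 2

/-- The expected fraction of cut edges of the output of the algorithm on `G`. -/
def expectedCutFraction (A : LocalAlgorithm) {V : Type u} [Fintype V] [DecidableEq V]
    (G : SimpleGraph V) [DecidableRel G.Adj] : ℝ :=
  ∑ z : V → ℤˣ, A.outputProb G z * cutFraction G z

end LocalAlgorithm

/-- The soft-threshold algorithm with rule `q`: the initial spins are independent and uniform on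
`{1, -1}`, and a vertex with initial spin `s`, exactly `m` of whose neighbours have the same initial
spin, ends with a spin of expectation `q m * s` (it flips with probability `(1 - q m) / 2`). -/
def softThreshold (q : ℕ → ℝ) (hq : ∀ m, q m ∈ Set.Icc (-1 : ℝ) 1) : LocalAlgorithm where
  State := ℤˣ
  prob := fun _ => 1 / 2
  prob_nonneg := fun _ => by norm_num
  prob_sum := by simp
  response := fun s N => q (N.count s) * ((s : ℤ) : ℝ)
  response_mem := fun s N => by
    have h := hq (N.count s)
    rw [Set.mem_Icc] at h ⊢
    rcases Int.units_eq_one_or s with rfl | rfl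
    · simpa using h
    · simp only [Units.val_neg, Units.val_one, Int.cast_neg, Int.cast_one]
      constructor <;> linarith [h.1, h.2]

/-- The rule of the threshold algorithm: flip if and only if at least `τ` neighbours agree. -/
def thresholdRule (τ : ℕ) (m : ℕ) : ℝ := if τ ≤ m then -1 else 1

theorem thresholdRule_mem (τ m : ℕ) : thresholdRule τ m ∈ Set.Icc (-1 : ℝ) 1 := by
  unfold thresholdRule; split_ifs <;> norm_num

/-- The threshold algorithm with threshold `τ`. -/
def thresholdAlgorithm (τ : ℕ) : LocalAlgorithm :=
  softThreshold (thresholdRule τ) (thresholdRule_mem τ)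

/-- The rule for degree 6: keep the spin if at most 3 neighbours agree, flip it if at least 5 agree,
and flip it with probability `0.35` if exactly 4 agree. -/
def softRuleSix (m : ℕ) : ℝ := if m ≤ 3 then 1 else if m = 4 then 3 / 10 else -1

theorem softRuleSix_mem (m : ℕ) : softRuleSix m ∈ Set.Icc (-1 : ℝ) 1 := by
  unfold softRuleSix; split_ifs <;> norm_num

/-- The rule for degree 11: keep the spin if at most 6 neighbours agree, flip it if at least 8
agree, and flip it with probability `0.55` if exactly 7 agree. -/
def softRuleEleven (m : ℕ) : ℝ := if m ≤ 6 then 1 else if m = 7 then -(1 / 10) else -1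

theorem softRuleEleven_mem (m : ℕ) : softRuleEleven m ∈ Set.Icc (-1 : ℝ) 1 := by
  unfold softRuleEleven; split_ifs <;> norm_num

/-- The binomial formula for the improvement over random of the soft-threshold algorithm. -/
def softThresholdImprovement (D : ℕ) (q : ℕ → ℝ) : ℝ :=
  1 / 4 * ((∑ n ∈ Finset.range D, ((D - 1).choose n : ℝ) / 2 ^ (D - 1) * q n) ^ 2
    - (∑ n ∈ Finset.range D, ((D - 1).choose n : ℝ) / 2 ^ (D - 1) * q (n + 1)) ^ 2)

/-! ### One-step local tensor algorithms -/

/-- A one-step local tensor algorithm for MAX-CUT. The entries of the vector `v₀` are independent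
copies of the real random variable `value`, defined on the finite probability space `(Seed, prob)`;
then `v₁ = g (v₀ + c J v₀)` entrywise, where `J` is minus the adjacency matrix, and finally the spins
are chosen independently given `v₁`, the spin of `i` with expectation `(v₁) i`. -/
structure TensorAlgorithm where
  Seed : Type
  [fintypeSeed : Fintype Seed]
  prob : Seed → ℝ
  prob_nonneg : ∀ s, 0 ≤ prob s
  prob_sum : ∑ s, prob s = 1
  value : Seed → ℝ
  c : ℝ
  g : ℝ → ℝ
  g_mem : ∀ x, g x ∈ Set.Icc (-1 : ℝ) 1

attribute [instance] TensorAlgorithm.fintypeSeed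

/-- A one-step tensor algorithm is a one-step local algorithm. -/
def TensorAlgorithm.toLocal (T : TensorAlgorithm) : LocalAlgorithm where
  State := T.Seed
  prob := T.prob
  prob_nonneg := T.prob_nonneg
  prob_sum := T.prob_sum
  response := fun s N => T.g (T.value s + T.c * -(N.map T.value).sum)
  response_mem := fun _ _ => T.g_mem _

/-- The one-step tensor algorithm with initial entries uniform on `{-1, -1/3, 1/3, 1}`, whose final
spin is the sign of `v₀ + c J v₀` (a uniformly random spin if that entry vanishes, since then its
expectation is `Real.sign 0 = 0`). -/
def fourValuedTensor (c : ℝ) : TensorAlgorithm where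
  Seed := Fin 4
  prob := fun _ => 1 / 4
  prob_nonneg := fun _ => by norm_num
  prob_sum := by simp
  value := ![-1, -(1 / 3), 1 / 3, 1]
  c := c
  g := Real.sign
  g_mem := fun x => by
    rcases Real.sign_apply_eq x with h | h | h <;> rw [h] <;> norm_num

/-! ### The one-step QAOA -/

/-- Entries of `exp (-i β X) = cos β - i sin β X`, with `X` the Pauli matrix exchanging the spins. -/
def mixerEntry (β : ℝ) (s t : ℤˣ) : ℂ :=
  if s = t then (Real.cos β : ℂ) else -Complex.I * (Real.sin β : ℂ)

/-- The amplitude at the basis state `z` of the one-step QAOA state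
`exp (-i β B) exp (-i γ C) |+⟩`, where `|+⟩` is the uniform superposition of all configurations,
`C` is the diagonal operator with entries `cutSize G`, and `B` is the sum of the Pauli `X` operators
over the vertices. -/
def qaoaAmplitude {V : Type u} [Fintype V] [DecidableEq V] (G : SimpleGraph V)
    [DecidableRel G.Adj] (γ β : ℝ) (z : V → ℤˣ) : ℂ :=
  ∑ y : V → ℤˣ, (∏ i, mixerEntry β (z i) (y i)) *
    (Complex.exp (-(Complex.I * (γ : ℂ) * (cutSize G y : ℂ))) *
      ((1 / Real.sqrt (2 ^ Fintype.card V) : ℝ) : ℂ))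

/-- The expected fraction of cut edges when the one-step QAOA state is measured in the computational
basis. -/
def qaoaCutFraction {V : Type u} [Fintype V] [DecidableEq V] (G : SimpleGraph V)
    [DecidableRel G.Adj] (γ β : ℝ) : ℝ :=
  ∑ z : V → ℤˣ, ‖qaoaAmplitude G γ β z‖ ^ 2 * cutFraction G z

/-- The value `1/2 + (1/(2√D)) (1 - 1/D)^((D-1)/2)`. -/
def qaoaValue (D : ℕ) : ℝ :=
  1 / 2 + 1 / (2 * Real.sqrt D) * (1 - 1 / (D : ℝ)) ^ (((D : ℝ) - 1) / 2)

/-- `P` holds for all finite non-empty triangle-free `D`-regular graphs. -/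
def ForAllTriangleFreeRegular (D : ℕ)
    (P : ∀ (V : Type u) [Fintype V] [DecidableEq V] (G : SimpleGraph V) [DecidableRel G.Adj], Prop) :
    Prop :=
  ∀ (V : Type u) [Fintype V] [DecidableEq V] [Nonempty V] (G : SimpleGraph V) [DecidableRel G.Adj],
    G.CliqueFree 3 → G.IsRegularOfDegree D → P V G

/-- The algorithm `A` cuts in expectation a larger fraction of the edges than the optimal one-step
QAOA value, on every finite non-empty triangle-free `D`-regular graph. -/
def BeatsQAOA (A : LocalAlgorithm) (D : ℕ) : Prop :=
  ForAllTriangleFreeRegular.{u} D fun _ _ _ G _ => qaoaValue D < A.expectedCutFraction G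

end

section

open Finset Function ComplexConjugate

/-! If all edges have the same spin correlation κ, the expected cut fraction is (1 - κ)/2
(`sum_mul_cutFraction`). After one step, κ on an edge ab involves only a, b and their other
neighbours. Without triangles these form two disjoint sets of D - 1 vertices, so with the data at a
and b fixed the averages over the two sets factor.

For a local algorithm, κ becomes a finite sum, over the initial states of a and b, of products of
two conditional means (`LocalAlgorithm.expectedCutFraction_eq`); for soft thresholds these means are
binomial sums. For the QAOA, the observable Z_a Z_b is conjugated by the mixer, only pairs of
configurations that agree off {a, b} contribute, and averaging the phases gives κ = -sin 4β sin γ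
cos^(D-1) γ. An elementary inequality maximises this over the angles (`isGreatest_qaoa`).

With N = D - 1, the QAOA gains half the square root of N^N / (N+1)^(N+1) over 1/2, so after squaring
each comparison is between rationals. The special degrees are finite checks; the range up to 1000 is
an integer computation by the kernel that updates one binomial coefficient from degree to degree
(`thresholdScan_thousand`). The last claim follows because a tensor algorithm with small c can
simulate any soft threshold (`softThresholdTensor_expectedCutFraction`). -/

/-- The mean of `F` over independent entries with common (signed) law `p`. -/
def prodMean {V S R : Type*} [Fintype V] [DecidableEq V] [Fintype S] [CommSemiring R] (p : S → R)
    (F : (V → S) → R) : R :=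
  ∑ y : V → S, (∏ i, p (y i)) * F y

/-- The mean of a function of the multiset of `k` independent draws from the law `p`. -/
def iidMean {S R : Type*} [Fintype S] [CommSemiring R] (p : S → R) : ℕ → (Multiset S → R) → R
  | 0, F => F 0
  | k + 1, F => ∑ s, p s * iidMean p k (fun N => F (s ::ₘ N))

/-! ### Averages over product measures -/

section prodMean

variable {V S R : Type*} [Fintype V] [DecidableEq V] [Fintype S] [CommSemiring R] {p : S → R}

theorem prodMean_prod (h : V → S → R) :
    prodMean p (fun y => ∏ i, h i (y i)) = ∏ i, ∑ s, p s * h i s := by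
  simp only [prodMean, ← Finset.prod_mul_distrib]
  rw [Finset.prod_univ_sum, Fintype.piFinset_univ]

theorem prodMean_const (hp : ∑ s, p s = 1) (c : R) :
    prodMean p (fun _ : V → S => c) = c := by
  have h := prodMean_prod (p := p) (fun (_ : V) (_ : S) => (1 : R))
  simp only [Finset.prod_const_one, mul_one, hp, prodMean] at h
  rw [prodMean, ← Finset.sum_mul, h, one_mul]

/-- Exchanging the entry at `u` with a spare independent draw is an involution that preserves the
product weight. -/
theorem prodMean_resample (hp : ∑ s, p s = 1) (u : V) (F : (V → S) → R) :
    prodMean p F = ∑ s, p s * prodMean p (fun y => F (update y u s)) := by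
  have hinv : Involutive (fun x : S × (V → S) => (x.2 u, update x.2 u x.1)) := by
    rintro ⟨s, y⟩; simp
  have hL : prodMean p F = ∑ x : S × (V → S), p x.1 * ((∏ i, p (x.2 i)) * F x.2) := by
    rw [Fintype.sum_prod_type]
    simp only [← Finset.mul_sum]
    rw [← Finset.sum_mul, hp, one_mul, prodMean]
  have hR : ∑ s, p s * prodMean p (fun y => F (update y u s)) =
      ∑ x : S × (V → S), p x.1 * ((∏ i, p (x.2 i)) * F (update x.2 u x.1)) := by
    rw [Fintype.sum_prod_type]
    simp only [prodMean, Finset.mul_sum]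
  rw [hL, hR]
  refine (Fintype.sum_bijective _ hinv.bijective _ _ ?_).symm
  rintro ⟨s, y⟩
  have h1 : ∏ i, p (update y u s i) = p s * ∏ i ∈ univ.erase u, p (y i) := by
    rw [← Finset.mul_prod_erase univ _ (mem_univ u), update_self]
    congr 1
    exact Finset.prod_congr rfl fun i hi => by rw [update_of_ne (Finset.ne_of_mem_erase hi)]
  simp only [h1]
  rw [← Finset.mul_prod_erase univ _ (mem_univ u)]
  ring

/-- Take two independent copies of the entries and exchange them on `B`. The joint weight is
unchanged, `F` still sees the first copy, and `H` now sees the second. -/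
theorem prodMean_mul_of_disjoint (hp : ∑ s, p s = 1) {A B : Finset V} (hAB : Disjoint A B)
    {F H : (V → S) → R} (hF : ∀ y y', (∀ i ∈ A, y i = y' i) → F y = F y')
    (hH : ∀ y y', (∀ i ∈ B, y i = y' i) → H y = H y') :
    prodMean p (fun y => F y * H y) = prodMean p F * prodMean p H := by
  let σ : (V → S) × (V → S) → (V → S) × (V → S) := fun x =>
    (fun i => if i ∈ B then x.2 i else x.1 i, fun i => if i ∈ B then x.1 i else x.2 i)
  have hinv : Involutive σ := by
    rintro ⟨y, y'⟩
    ext i <;> by_cases h : i ∈ B <;> simp [σ, h]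
  have hL : prodMean p (fun y => F y * H y) = ∑ x : (V → S) × (V → S),
      ((∏ i, p (x.1 i)) * ∏ i, p (x.2 i)) * (F x.1 * H x.1) := by
    rw [Fintype.sum_prod_type]
    refine Finset.sum_congr rfl fun y _ => ?_
    have h := prodMean_const (V := V) hp ((∏ i, p (y i)) * (F y * H y))
    rw [← h]
    exact Finset.sum_congr rfl fun y' _ => by ring
  have hR : prodMean p F * prodMean p H = ∑ x : (V → S) × (V → S),
      ((∏ i, p (x.1 i)) * ∏ i, p (x.2 i)) * (F x.1 * H x.2) := by
    rw [Fintype.sum_prod_type, prodMean, prodMean, Finset.sum_mul_sum]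
    exact Finset.sum_congr rfl fun y _ => Finset.sum_congr rfl fun y' _ => by ring
  rw [hL, hR]
  refine Fintype.sum_bijective σ hinv.bijective _ _ ?_
  rintro ⟨y, y'⟩
  have hw : (∏ i, p ((σ (y, y')).1 i)) * ∏ i, p ((σ (y, y')).2 i) =
      (∏ i, p (y i)) * ∏ i, p (y' i) := by
    rw [← Finset.prod_mul_distrib, ← Finset.prod_mul_distrib]
    refine Finset.prod_congr rfl fun i _ => ?_
    by_cases h : i ∈ B <;> simp [σ, h, mul_comm]
  rw [hw]
  congr 2
  · refine hF _ _ fun i hi => ?_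
    simp [σ, Finset.disjoint_left.1 hAB hi]
  · refine hH _ _ fun i hi => ?_
    simp [σ, hi]

/-- Resampling the vertices of `B` one at a time exposes the draws of `iidMean`. -/
theorem prodMean_multiset (hp : ∑ s, p s = 1) (B : Finset V) (F : Multiset S → R) :
    prodMean p (fun y : V → S => F (B.val.map y)) = iidMean p B.card F := by
  induction B using Finset.induction_on generalizing F with
  | empty => simp [iidMean, prodMean_const hp]
  | insert b B hb ih =>
    rw [prodMean_resample hp b, Finset.card_insert_of_notMem hb, iidMean]
    refine Finset.sum_congr rfl fun s _ => ?_
    rw [← ih]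
    congr 2
    funext y
    rw [Finset.insert_val_of_notMem hb, Multiset.map_cons, update_self]
    congr 2
    refine Multiset.map_congr rfl fun i hi => update_of_ne ?_ _ _
    rintro rfl
    exact hb hi

end prodMean

/-! ### Cut fraction and edge correlations -/

section Cut

theorem edgeFinset_card_pos {V : Type*} [Fintype V] [Nonempty V]
    (G : SimpleGraph V) [DecidableRel G.Adj] {D : ℕ} (hD : 1 ≤ D)
    (hreg : G.IsRegularOfDegree D) :
    0 < G.edgeFinset.card := by
  obtain ⟨v⟩ := ‹Nonempty V›
  have h : 0 < G.degree v := by rw [hreg v]; omega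
  obtain ⟨w, hw⟩ := (G.degree_pos_iff_exists_adj v).1 h
  exact Finset.card_pos.2 ⟨s(v, w), by simpa using hw⟩

variable {V : Type u} [Fintype V] [DecidableEq V] (G : SimpleGraph V) [DecidableRel G.Adj]

/-- The spin as a real number. -/
abbrev spinVal (s : ℤˣ) : ℝ := ((s : ℤ) : ℝ)

theorem cutSize_eq_sum (z : V → ℤˣ) :
    (cutSize G z : ℝ) =
      ∑ e ∈ G.edgeFinset, if ¬ (e.map z).IsDiag then (1 : ℝ) else 0 := by
  rw [cutSize, Finset.card_filter]
  push_cast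
  rfl

theorem ite_ne_spin (a b : ℤˣ) :
    (if ¬ a = b then (1 : ℝ) else 0) = (1 - spinVal a * spinVal b) / 2 := by
  rcases Int.units_eq_one_or a with rfl | rfl <;> rcases Int.units_eq_one_or b with rfl | rfl <;>
    norm_num [spinVal]

/-- The mean cut fraction of a law whose spins have the same correlation along all edges. -/
theorem sum_mul_cutFraction (hE : 0 < G.edgeFinset.card) (W : (V → ℤˣ) → ℝ) (hW : ∑ z, W z = 1)
    (κ : ℝ) (hκ : ∀ a b, G.Adj a b → ∑ z, W z * (spinVal (z a) * spinVal (z b)) = κ) :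
    ∑ z, W z * cutFraction G z = (1 - κ) / 2 := by
  have hE' : (G.edgeFinset.card : ℝ) ≠ 0 := by positivity
  have key : ∑ z, W z * (cutSize G z : ℝ) = G.edgeFinset.card * ((1 - κ) / 2) := by
    simp only [cutSize_eq_sum, Finset.mul_sum]
    rw [Finset.sum_comm, ← nsmul_eq_mul]
    refine Finset.sum_eq_card_nsmul fun e he => ?_
    induction e using Sym2.ind with
    | _ a b =>
      simp only [Sym2.map_mk, Sym2.mk_isDiag_iff, ite_ne_spin]
      rw [← hκ a b (by simpa using he)]
      -- The constant 1 is spread as the total mass of `W`, so that both sides are sums over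
      -- configurations.
      nth_rewrite 2 [← hW]
      rw [← Finset.sum_sub_distrib, Finset.sum_div]
      exact Finset.sum_congr rfl fun z _ => by ring
  simp only [cutFraction, ← mul_div_assoc]
  rw [← Finset.sum_div, key]
  field_simp

/-- A common neighbour would close a triangle. This is the only point where triangle-freeness
enters. -/
theorem disjoint_neighborFinset_erase (htri : G.CliqueFree 3) {a b : V} (hab : G.Adj a b) :
    Disjoint ((G.neighborFinset a).erase b) ((G.neighborFinset b).erase a) := by
  rw [Finset.disjoint_left]
  intro c hc hc'
  have h1 : G.Adj a c := by simpa using (Finset.mem_erase.1 hc).2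
  have h2 : G.Adj b c := by simpa using (Finset.mem_erase.1 hc').2
  exact htri {a, b, c} (SimpleGraph.is3Clique_triple_iff.2 ⟨hab, h1, h2⟩)

theorem card_neighborFinset_erase {D : ℕ} (hreg : G.IsRegularOfDegree D) {a b : V}
    (hab : G.Adj a b) : ((G.neighborFinset a).erase b).card = D - 1 := by
  rw [Finset.card_erase_of_mem (by simpa using hab), SimpleGraph.card_neighborFinset_eq_degree,
    hreg a]

end Cut

/-! ### Edge correlation of a local algorithm -/

namespace LocalAlgorithm

variable (A : LocalAlgorithm) {V : Type u} [Fintype V] [DecidableEq V] (G : SimpleGraph V)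
  [DecidableRel G.Adj]

theorem sum_spin_prod (m : V → ℝ) (χ : V → ℤˣ → ℝ) :
    ∑ z : V → ℤˣ, (∏ i, (1 + spinVal (z i) * m i) / 2) * ∏ i, χ i (z i) =
      ∏ i, ((1 + m i) / 2 * χ i 1 + (1 - m i) / 2 * χ i (-1)) := by
  simp only [← Finset.prod_mul_distrib]
  have h := Finset.prod_univ_sum (fun _ : V => (univ : Finset ℤˣ))
    (fun i s => (1 + spinVal s * m i) / 2 * χ i s)
  rw [Fintype.piFinset_univ] at h
  rw [← h]
  refine Finset.prod_congr rfl fun i _ => ?_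
  have : (univ : Finset ℤˣ) = {1, -1} := rfl
  rw [this, Finset.sum_pair (by decide)]
  simp [spinVal, sub_eq_add_neg]

/-- Given the initial states the final spins are independent, so a product observable averages
vertex by vertex. -/
theorem sum_outputProb_mul_prod (χ : V → ℤˣ → ℝ) :
    ∑ z, A.outputProb G z * ∏ i, χ i (z i) = prodMean A.prob fun v =>
      ∏ i, ((1 + A.spinMean G v i) / 2 * χ i 1 + (1 - A.spinMean G v i) / 2 * χ i (-1)) := by
  simp only [outputProb, Finset.sum_mul, prodMean, mul_assoc]
  rw [Finset.sum_comm]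
  refine Finset.sum_congr rfl fun v _ => ?_
  rw [← Finset.mul_sum, ← sum_spin_prod]

theorem sum_outputProb : ∑ z, A.outputProb G z = 1 := by
  have h := A.sum_outputProb_mul_prod G (fun _ _ => 1)
  simp only [Finset.prod_const_one, mul_one] at h
  rw [h]
  ring_nf
  simp only [Finset.prod_const_one]
  exact prodMean_const A.prob_sum 1

/-- The mean spin of a vertex in state `s` with a neighbour in state `t`. -/
noncomputable def pairMean (D : ℕ) (s t : A.State) : ℝ :=
  iidMean A.prob (D - 1) fun N => A.response s (t ::ₘ N)

/-- The second configuration `y` lets the values resampled at the two endpoints be forgotten at the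
remaining neighbours. -/
theorem spinMean_eq {a b : V} (hab : G.Adj a b) {v y : V → A.State}
    (h : ∀ i ∈ (G.neighborFinset a).erase b, v i = y i) :
    A.spinMean G v a =
      A.response (v a) (v b ::ₘ ((G.neighborFinset a).erase b).val.map y) := by
  have hb : b ∈ G.neighborFinset a := by simpa using hab
  rw [spinMean]
  conv_lhs => rw [← Finset.insert_erase hb]
  rw [Finset.insert_val_of_notMem (Finset.notMem_erase b _), Multiset.map_cons]
  congr 2
  exact Multiset.map_congr rfl fun i hi => h i hi

/-- Fix the states s of a and t of b by resampling. The two conditional spin means then depend on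
the disjoint sets of remaining neighbours, hence are independent. -/
theorem sum_outputProb_mul_spins {D : ℕ} (htri : G.CliqueFree 3) (hreg : G.IsRegularOfDegree D)
    {a b : V} (hab : G.Adj a b) :
    ∑ z, A.outputProb G z * (spinVal (z a) * spinVal (z b)) =
      ∑ s, ∑ t, A.prob s * A.prob t * (A.pairMean D s t * A.pairMean D t s) := by
  have hne : a ≠ b := hab.ne
  have h1 : ∀ z : V → ℤˣ, spinVal (z a) * spinVal (z b) =
      ∏ i, (if i = a ∨ i = b then spinVal (z i) else 1) := by
    intro z
    rw [← Finset.prod_filter]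
    have : univ.filter (fun i => i = a ∨ i = b) = {a, b} := by ext; simp
    rw [this, Finset.prod_pair hne]
  have h2 : ∀ v : V → A.State, (∏ i, ((1 + A.spinMean G v i) / 2 *
      (if i = a ∨ i = b then spinVal 1 else 1) + (1 - A.spinMean G v i) / 2 *
      (if i = a ∨ i = b then spinVal (-1) else 1))) = A.spinMean G v a * A.spinMean G v b := by
    intro v
    have : ∀ i, ((1 + A.spinMean G v i) / 2 *
      (if i = a ∨ i = b then spinVal 1 else 1) + (1 - A.spinMean G v i) / 2 *
      (if i = a ∨ i = b then spinVal (-1) else 1)) =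
        if i = a ∨ i = b then A.spinMean G v i else 1 := by
      intro i
      split_ifs <;> simp [spinVal] <;> ring
    simp only [this]
    rw [← Finset.prod_filter]
    have : univ.filter (fun i => i = a ∨ i = b) = {a, b} := by ext; simp
    rw [this, Finset.prod_pair hne]
  simp only [h1]
  rw [A.sum_outputProb_mul_prod G (fun i s => if i = a ∨ i = b then spinVal s else 1)]
  simp only [h2]
  rw [prodMean_resample A.prob_sum a]
  refine Finset.sum_congr rfl fun s _ => ?_
  rw [prodMean_resample A.prob_sum b, Finset.mul_sum]
  refine Finset.sum_congr rfl fun t _ => ?_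
  rw [← mul_assoc]
  congr 1
  have hA : ∀ y : V → A.State, A.spinMean G (update (update y b t) a s) a =
      A.response s (t ::ₘ ((G.neighborFinset a).erase b).val.map y) := by
    intro y
    rw [A.spinMean_eq G hab (y := y), update_self, update_of_ne hne.symm, update_self]
    intro i hi
    have hi' := Finset.mem_erase.1 hi
    have hia : i ≠ a := by
      rintro rfl
      simp at hi'
    rw [update_of_ne hia, update_of_ne hi'.1]
  have hB : ∀ y : V → A.State, A.spinMean G (update (update y b t) a s) b =
      A.response t (s ::ₘ ((G.neighborFinset b).erase a).val.map y) := by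
    intro y
    rw [A.spinMean_eq G hab.symm (y := y), update_self, update_of_ne hne.symm, update_self]
    intro i hi
    have hi' := Finset.mem_erase.1 hi
    have hib : i ≠ b := by
      rintro rfl
      simp at hi'
    rw [update_of_ne hi'.1, update_of_ne hib]
  simp only [hA, hB]
  rw [prodMean_mul_of_disjoint A.prob_sum (disjoint_neighborFinset_erase G htri hab)
    (F := fun y => A.response s (t ::ₘ ((G.neighborFinset a).erase b).val.map y))
    (H := fun y => A.response t (s ::ₘ ((G.neighborFinset b).erase a).val.map y))]
  · rw [prodMean_multiset A.prob_sum _ (fun N => A.response s (t ::ₘ N)),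
      prodMean_multiset A.prob_sum _ (fun N => A.response t (s ::ₘ N)),
      card_neighborFinset_erase G hreg hab, card_neighborFinset_erase G hreg hab.symm]
    rfl
  · intro y y' h
    rw [Multiset.map_congr rfl fun i hi => h i hi]
  · intro y y' h
    rw [Multiset.map_congr rfl fun i hi => h i hi]

theorem expectedCutFraction_eq [Nonempty V] {D : ℕ} (hD : 1 ≤ D) (htri : G.CliqueFree 3)
    (hreg : G.IsRegularOfDegree D) :
    A.expectedCutFraction G =
      (1 - ∑ s, ∑ t, A.prob s * A.prob t * (A.pairMean D s t * A.pairMean D t s)) / 2 :=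
  sum_mul_cutFraction G (edgeFinset_card_pos G hD hreg) _ (A.sum_outputProb G) _
    fun _ _ hab => A.sum_outputProb_mul_spins G htri hreg hab

end LocalAlgorithm

/-! ### The binomial formula for soft thresholds -/

theorem iidMean_mul_left {S R : Type*} [Fintype S] [CommSemiring R] (p : S → R) (k : ℕ) (c : R)
    (F : Multiset S → R) : iidMean p k (fun N => c * F N) = c * iidMean p k F := by
  induction k generalizing F with
  | zero => rfl
  | succ k ih =>
    simp only [iidMean, ih, Finset.mul_sum]
    exact Finset.sum_congr rfl fun s _ => by ring

theorem sum_choose_succ_mul (k : ℕ) (f : ℕ → ℝ) :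
    ∑ n ∈ range (k + 2), ((k + 1).choose n : ℝ) * f n =
      ∑ n ∈ range (k + 1), (k.choose n : ℝ) * f n +
        ∑ n ∈ range (k + 1), (k.choose n : ℝ) * f (n + 1) := by
  have h0 : ∑ n ∈ range (k + 1), (k.choose n : ℝ) * f n =
      ∑ n ∈ range (k + 1), (k.choose (n + 1) : ℝ) * f (n + 1) + f 0 := by
    rw [Finset.sum_range_succ' _ k, Finset.sum_range_succ _ k]
    simp
  rw [h0, Finset.sum_range_succ']
  simp only [Nat.choose_succ_succ, Nat.cast_add, add_mul, Finset.sum_add_distrib]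
  simp
  ring

theorem sum_units {R : Type*} [AddCommMonoid R] (f : ℤˣ → R) : ∑ s, f s = f 1 + f (-1) := by
  have : (univ : Finset ℤˣ) = {1, -1} := rfl
  rw [this, Finset.sum_pair (by decide)]

/-- The number of agreeing uniform spins is binomial; the induction step is Pascal's rule,
`sum_choose_succ_mul`. -/
theorem iidMean_count (s : ℤˣ) (k : ℕ) (f : ℕ → ℝ) :
    iidMean (fun _ : ℤˣ => (1 / 2 : ℝ)) k (fun N => f (N.count s)) =
      ∑ n ∈ range (k + 1), (k.choose n : ℝ) / 2 ^ k * f n := by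
  induction k generalizing f with
  | zero => simp [iidMean]
  | succ k ih =>
    have h : ∀ t : ℤˣ, iidMean (fun _ : ℤˣ => (1 / 2 : ℝ)) k (fun N => f ((t ::ₘ N).count s)) =
        if t = s then ∑ n ∈ range (k + 1), (k.choose n : ℝ) / 2 ^ k * f (n + 1)
        else ∑ n ∈ range (k + 1), (k.choose n : ℝ) / 2 ^ k * f n := by
      intro t
      split_ifs with hts
      · subst hts
        simp only [Multiset.count_cons_self]
        exact ih (fun n => f (n + 1))
      · simp only [Multiset.count_cons_of_ne (Ne.symm hts)]
        exact ih f
    have hsum := sum_choose_succ_mul k f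
    simp only [div_mul_eq_mul_div, ← Finset.sum_div] at h ⊢
    simp only [iidMean, h]
    rw [hsum, sum_units]
    rcases Int.units_eq_one_or s with rfl | rfl <;> norm_num <;> ring

theorem softThreshold_pairMean (q : ℕ → ℝ) (hq : ∀ m, q m ∈ Set.Icc (-1 : ℝ) 1) (D : ℕ)
    (s t : ℤˣ) :
    (softThreshold q hq).pairMean (D + 1) s t = spinVal s *
      if t = s then ∑ n ∈ range (D + 1), (D.choose n : ℝ) / 2 ^ D * q (n + 1)
      else ∑ n ∈ range (D + 1), (D.choose n : ℝ) / 2 ^ D * q n := by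
  have h : (softThreshold q hq).pairMean (D + 1) s t = spinVal s *
      iidMean (fun _ : ℤˣ => (1 / 2 : ℝ)) D (fun N => q ((t ::ₘ N).count s)) := by
    rw [← iidMean_mul_left]
    simp only [LocalAlgorithm.pairMean, softThreshold, Nat.add_sub_cancel, spinVal]
    congr 1
    funext N
    exact mul_comm _ _
  rw [h]
  split_ifs with hts
  · subst hts
    simp only [Multiset.count_cons_self]
    rw [iidMean_count t D (fun n => q (n + 1))]
  · simp only [Multiset.count_cons_of_ne (Ne.symm hts)]
    rw [iidMean_count]

/-- Write A and B for the binomial means of q(n) and q(n+1). Endpoints that start equal have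
conditional means sB, sB; endpoints that start opposite have sA, -sA. Each case has probability 1/2,
so the correlation is (B² - A²)/2. -/
theorem softThreshold_expectedCutFraction (q : ℕ → ℝ) (hq : ∀ m, q m ∈ Set.Icc (-1 : ℝ) 1) {D : ℕ}
    (hD : 1 ≤ D) {V : Type u} [Fintype V] [DecidableEq V] [Nonempty V] (G : SimpleGraph V)
    [DecidableRel G.Adj] (htri : G.CliqueFree 3) (hreg : G.IsRegularOfDegree D) :
    (softThreshold q hq).expectedCutFraction G = 1 / 2 + softThresholdImprovement D q := by
  rw [LocalAlgorithm.expectedCutFraction_eq _ G hD htri hreg]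
  obtain ⟨N, rfl⟩ : ∃ N, D = N + 1 := ⟨D - 1, by omega⟩
  change (1 - ∑ s : ℤˣ, ∑ t : ℤˣ, (1 / 2 : ℝ) * (1 / 2) *
    ((softThreshold q hq).pairMean (N + 1) s t * (softThreshold q hq).pairMean (N + 1) t s)) / 2 = _
  simp only [softThreshold_pairMean, sum_units]
  have h1 : (1 : ℤˣ) ≠ -1 := by decide
  simp only [h1, h1.symm, if_true, if_false, softThresholdImprovement, Nat.add_sub_cancel]
  simp [spinVal]
  ring

/-! ### Soft thresholds as tensor algorithms -/

theorem count_add_sum_units (N : Multiset ℤˣ) (s : ℤˣ) :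
    spinVal s * (N.map spinVal).sum = 2 * (N.count s : ℝ) - N.card := by
  induction N using Multiset.induction_on with
  | empty => simp
  | cons t N ih =>
    rw [Multiset.map_cons, Multiset.sum_cons, mul_add, ih, Multiset.card_cons, Multiset.count_cons]
    rcases Int.units_eq_one_or s with rfl | rfl <;>
      rcases Int.units_eq_one_or t with rfl | rfl <;> norm_num [spinVal] <;> ring

/-- The tensor algorithm simulating the soft-threshold algorithm with rule `q` in degree `D`: after
the linear step with the small constant `c = 1 / (2D)` the entry of a vertex with initial spin `s`
and `m` agreeing neighbours is `s (3/2 - m / D)`, which determines `s` and `m`. -/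
noncomputable def softThresholdTensor (D : ℕ) (q : ℕ → ℝ) (hq : ∀ m, q m ∈ Set.Icc (-1 : ℝ) 1) :
    TensorAlgorithm where
  Seed := ℤˣ
  prob := fun _ => 1 / 2
  prob_nonneg := fun _ => by norm_num
  prob_sum := by simp
  value := spinVal
  c := 1 / (2 * D)
  g := fun x => q ⌊3 * (D : ℝ) / 2 - D * |x|⌋₊ * Real.sign x
  g_mem := fun x => by
    have h := hq ⌊3 * (D : ℝ) / 2 - D * |x|⌋₊
    rw [Set.mem_Icc] at h ⊢
    rcases Real.sign_apply_eq x with h' | h' | h' <;> rw [h'] <;> constructor <;> linarith [h.1, h.2]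

/-- As m ≤ D, the factor 3/2 - m/D is positive: the sign of the entry recovers s and its absolute
value recovers m. -/
theorem softThresholdTensor_response {D : ℕ} (hD : 1 ≤ D) (q : ℕ → ℝ)
    (hq : ∀ m, q m ∈ Set.Icc (-1 : ℝ) 1) (s : ℤˣ) (N : Multiset ℤˣ) (hN : N.card = D) :
    (softThresholdTensor D q hq).toLocal.response s N = (softThreshold q hq).response s N := by
  have hD' : (0 : ℝ) < D := by exact_mod_cast hD
  have hs : spinVal s * spinVal s = 1 := by
    rcases Int.units_eq_one_or s with rfl | rfl <;> norm_num [spinVal]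
  have hm : (N.count s : ℝ) ≤ D := by exact_mod_cast hN ▸ N.count_le_card s
  have hsum : (N.map spinVal).sum = spinVal s * (2 * (N.count s : ℝ) - D) := by
    rw [← hN, ← count_add_sum_units, ← mul_assoc, hs, one_mul]
  have hx : spinVal s + 1 / (2 * D) * -(N.map spinVal).sum =
      spinVal s * (3 / 2 - N.count s / D) := by
    rw [hsum]
    field_simp
    ring
  have hpos : 0 < 3 / 2 - (N.count s : ℝ) / D := by
    have : (N.count s : ℝ) / D ≤ 1 := (div_le_one hD').2 hm
    linarith
  have habs : |spinVal s * (3 / 2 - N.count s / D)| = 3 / 2 - N.count s / D := by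
    rw [abs_mul, abs_of_pos hpos]
    rcases Int.units_eq_one_or s with rfl | rfl <;> simp [spinVal]
  have hsign : Real.sign (spinVal s * (3 / 2 - N.count s / D)) = spinVal s := by
    rcases Int.units_eq_one_or s with rfl | rfl
    · simpa [spinVal] using Real.sign_of_pos hpos
    · simpa [spinVal] using Real.sign_of_neg (neg_lt_zero.2 hpos)
  change q ⌊3 * (D : ℝ) / 2 - D * |spinVal s + 1 / (2 * D) * -(N.map spinVal).sum|⌋₊ *
    Real.sign (spinVal s + 1 / (2 * D) * -(N.map spinVal).sum) = q (N.count s) * spinVal s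
  rw [hx, habs, hsign]
  have : 3 * (D : ℝ) / 2 - D * (3 / 2 - N.count s / D) = N.count s := by
    field_simp
    ring
  rw [this, Nat.floor_natCast]

theorem softThresholdTensor_expectedCutFraction {D : ℕ} (hD : 1 ≤ D) (q : ℕ → ℝ)
    (hq : ∀ m, q m ∈ Set.Icc (-1 : ℝ) 1) {V : Type u} [Fintype V] [DecidableEq V]
    (G : SimpleGraph V) [DecidableRel G.Adj] (hreg : G.IsRegularOfDegree D) :
    (softThresholdTensor D q hq).toLocal.expectedCutFraction G =
      (softThreshold q hq).expectedCutFraction G := by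
  have h : ∀ (v : V → ℤˣ) (i : V), (softThresholdTensor D q hq).toLocal.spinMean G v i =
      (softThreshold q hq).spinMean G v i := fun v i =>
    softThresholdTensor_response hD q hq _ _ 
      ((Multiset.card_map _ _).trans ((G.card_neighborFinset_eq_degree i).trans (hreg i)))
  refine Finset.sum_congr rfl fun z _ => ?_
  congr 1
  refine Finset.sum_congr rfl fun v _ => ?_
  congr 1
  exact Finset.prod_congr rfl fun i _ => by rw [h v i]

theorem BeatsQAOA.exists_tensor {D : ℕ} (hD : 1 ≤ D) {q : ℕ → ℝ}
    {hq : ∀ m, q m ∈ Set.Icc (-1 : ℝ) 1} (h : BeatsQAOA.{u} (softThreshold q hq) D) :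
    ∃ T : TensorAlgorithm, BeatsQAOA.{u} T.toLocal D := by
  refine ⟨softThresholdTensor D q hq, fun V _ _ _ G _ htri hreg => ?_⟩
  change qaoaValue D < _
  rw [softThresholdTensor_expectedCutFraction hD q hq G hreg]
  exact h V G htri hreg

/-! ### Change of the cut size when spins are replaced -/

section CutUpdate

variable {V : Type u} [Fintype V] [DecidableEq V] (G : SimpleGraph V) [DecidableRel G.Adj]

theorem incidenceFinset_eq_image (a : V) :
    G.incidenceFinset a = (G.neighborFinset a).image fun b => s(a, b) := by
  ext e
  induction e using Sym2.ind with
  | _ x y =>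
    simp only [SimpleGraph.mem_incidenceFinset, Finset.mem_image, SimpleGraph.mem_neighborFinset,
      SimpleGraph.mk'_mem_incidenceSet_iff, Sym2.eq_iff]
    constructor
    · rintro ⟨h, rfl | rfl⟩
      · exact ⟨y, h, Or.inl ⟨rfl, rfl⟩⟩
      · exact ⟨x, h.symm, Or.inr ⟨rfl, rfl⟩⟩
    · rintro ⟨b, h, ⟨rfl, rfl⟩ | ⟨rfl, rfl⟩⟩
      · exact ⟨h, Or.inl rfl⟩
      · exact ⟨h.symm, Or.inr rfl⟩

theorem cutSize_update (y : V → ℤˣ) (a : V) (s : ℤˣ) :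
    (cutSize G (update y a s) : ℝ) = cutSize G y +
      1 / 2 * (spinVal (y a) - spinVal s) * ∑ j ∈ G.neighborFinset a, spinVal (y j) := by
  have h : (cutSize G (update y a s) : ℝ) - cutSize G y =
      ∑ e ∈ G.incidenceFinset a, ((if ¬ (e.map (update y a s)).IsDiag then (1 : ℝ) else 0) -
        if ¬ (e.map y).IsDiag then (1 : ℝ) else 0) := by
    rw [cutSize_eq_sum, cutSize_eq_sum, ← Finset.sum_sub_distrib]
    refine (Finset.sum_subset (G.incidenceFinset_subset a) fun e he he' => ?_).symm
    induction e using Sym2.ind with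
    | _ x z =>
      have hadj : G.Adj x z := by simpa using he
      have hx : ¬ (a = x ∨ a = z) := fun hx => he' (by
        rw [SimpleGraph.mem_incidenceFinset, SimpleGraph.mk'_mem_incidenceSet_iff]
        exact ⟨hadj, hx⟩)
      push Not at hx
      have : Sym2.map (update y a s) s(x, z) = Sym2.map y s(x, z) := by
        simp only [Sym2.map_mk, update_of_ne hx.1.symm, update_of_ne hx.2.symm]
      rw [this, sub_self]
  rw [← sub_eq_iff_eq_add', h, incidenceFinset_eq_image, Finset.sum_image, Finset.mul_sum]
  · refine Finset.sum_congr rfl fun b hb => ?_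
    have hab : b ≠ a := by
      rintro rfl
      simp at hb
    simp only [Sym2.map_mk, Sym2.mk_isDiag_iff, update_self, update_of_ne hab, ite_ne_spin]
    ring
  · intro b _ c _ hbc
    rcases Sym2.eq_iff.1 hbc with h | h
    · exact h.2
    · exact h.2.trans h.1

/-- The edge ab is split off because both its ends change; what remains is linear in the spins of
the two disjoint neighbourhoods, as the phase average needs. -/
theorem cutSize_update_update {a b : V} (hab : G.Adj a b) (y : V → ℤˣ) (s t s' t' : ℤˣ) :
    (cutSize G (update (update (update (update y b t) a s) a s') b t') : ℝ) =
      cutSize G (update (update y b t) a s) +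
        (1 / 2 * (spinVal s * spinVal t - spinVal s' * spinVal t') +
        1 / 2 * (spinVal s - spinVal s') *
          ∑ j ∈ (G.neighborFinset a).erase b, spinVal (y j) +
        1 / 2 * (spinVal t - spinVal t') *
          ∑ j ∈ (G.neighborFinset b).erase a, spinVal (y j)) := by
  have hne := hab.ne
  have hb : b ∈ G.neighborFinset a := by simpa using hab
  have ha : a ∈ G.neighborFinset b := by simpa using hab.symm
  rw [cutSize_update, cutSize_update, ← Finset.add_sum_erase _ _ hb, ← Finset.add_sum_erase _ _ ha]
  have h1 : ∑ j ∈ (G.neighborFinset a).erase b, spinVal (update (update y b t) a s j) =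
      ∑ j ∈ (G.neighborFinset a).erase b, spinVal (y j) := by
    refine Finset.sum_congr rfl fun j hj => ?_
    have hj' := Finset.mem_erase.1 hj
    have hja : j ≠ a := by
      rintro rfl
      simp at hj'
    rw [update_of_ne hja, update_of_ne hj'.1]
  have h2 : ∑ j ∈ (G.neighborFinset b).erase a,
      spinVal (update (update (update y b t) a s) a s' j) =
      ∑ j ∈ (G.neighborFinset b).erase a, spinVal (y j) := by
    refine Finset.sum_congr rfl fun j hj => ?_
    have hj' := Finset.mem_erase.1 hj
    have hjb : j ≠ b := by
      rintro rfl
      simp at hj'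
    rw [update_of_ne hj'.1, update_of_ne hj'.1, update_of_ne hjb]
  rw [h1, h2]
  simp only [update_self, update_of_ne hne.symm]
  ring

end CutUpdate

/-! ### Edge correlation of the one-step QAOA -/

section QAOA

variable {V : Type u} [Fintype V] [DecidableEq V] (G : SimpleGraph V) [DecidableRel G.Adj]

/-- Entries of `exp (i β X) χ exp (-i β X)` for a diagonal one-qubit observable `χ`. -/
noncomputable def mixerConj (β : ℝ) (χ : ℤˣ → ℂ) (a b : ℤˣ) : ℂ :=
  ∑ s, χ s * (mixerEntry β s a * conj (mixerEntry β s b))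

/-- Unitarity of the one-qubit mixer. -/
theorem mixerConj_one (β : ℝ) (a b : ℤˣ) :
    mixerConj β (fun _ => 1) a b = if a = b then 1 else 0 := by
  have h : (Real.cos β : ℂ) ^ 2 + (Real.sin β : ℂ) ^ 2 = 1 := by
    exact_mod_cast Real.cos_sq_add_sin_sq β
  have hI : Complex.I ^ 2 = -1 := Complex.I_sq
  have h1 : (1 : ℤˣ) ≠ -1 := by decide
  rcases Int.units_eq_one_or a with rfl | rfl <;> rcases Int.units_eq_one_or b with rfl | rfl <;>
    simp only [mixerConj, sum_units, mixerEntry, h1, h1.symm, if_true, if_false, map_mul, map_neg,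
      Complex.conj_I, Complex.conj_ofReal]
  · linear_combination h - (Real.sin β : ℂ) ^ 2 * hI
  · ring
  · ring
  · linear_combination h - (Real.sin β : ℂ) ^ 2 * hI

/-- Conjugation by exp(-iβX) rotates the Pauli Z by the angle 2β about the X axis. -/
theorem mixerConj_spin (β : ℝ) (a b : ℤˣ) :
    mixerConj β (fun s => (spinVal s : ℂ)) a b =
      (spinVal a : ℂ) * if a = b then (Real.cos (2 * β) : ℂ)
        else Complex.I * (Real.sin (2 * β) : ℂ) := by
  have hI : Complex.I ^ 2 = -1 := Complex.I_sq
  have h1 : (1 : ℤˣ) ≠ -1 := by decide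
  have hs : spinVal 1 = 1 := by simp [spinVal]
  have hs' : spinVal (-1) = -1 := by simp [spinVal]
  rw [Real.cos_two_mul', Real.sin_two_mul]
  rcases Int.units_eq_one_or a with rfl | rfl <;> rcases Int.units_eq_one_or b with rfl | rfl <;>
    simp only [mixerConj, sum_units, mixerEntry, h1, h1.symm, if_true, if_false, map_mul, map_neg,
      Complex.conj_I, Complex.conj_ofReal, hs, hs', Complex.ofReal_sub, Complex.ofReal_mul,
      Complex.ofReal_pow, Complex.ofReal_neg, Complex.ofReal_one, Complex.ofReal_ofNat]
  · linear_combination (Real.sin β : ℂ) ^ 2 * hI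
  · ring
  · ring
  · linear_combination -(Real.sin β : ℂ) ^ 2 * hI

/-- The amplitudes after the phase step of the one-step QAOA. -/
noncomputable def phaseAmplitude (γ : ℝ) (y : V → ℤˣ) : ℂ :=
  Complex.exp (-(Complex.I * (γ : ℂ) * (cutSize G y : ℂ))) *
    ((1 / Real.sqrt (2 ^ Fintype.card V) : ℝ) : ℂ)

theorem phaseAmplitude_mul_conj (γ : ℝ) (y y' : V → ℤˣ) :
    phaseAmplitude G γ y * conj (phaseAmplitude G γ y') =
      1 / 2 ^ Fintype.card V *
        Complex.exp (Complex.I * γ * ((cutSize G y' : ℝ) - (cutSize G y : ℝ) : ℝ)) := by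
  have hr : ((1 / Real.sqrt (2 ^ Fintype.card V) : ℝ) : ℂ) *
      ((1 / Real.sqrt (2 ^ Fintype.card V) : ℝ) : ℂ) = 1 / 2 ^ Fintype.card V := by
    rw [← Complex.ofReal_mul, div_mul_div_comm, Real.mul_self_sqrt (by positivity)]
    push_cast
    ring
  rw [phaseAmplitude, phaseAmplitude, map_mul, Complex.conj_ofReal, ← Complex.exp_conj,
    mul_mul_mul_comm, ← Complex.exp_add, hr, mul_comm]
  congr 2
  simp only [map_neg, map_mul, Complex.conj_I, Complex.conj_ofReal, map_natCast]
  push_cast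
  ring

/-- The Heisenberg picture: the mixer is a tensor product, so the conjugated product observable
factors over the vertices. -/
theorem sum_qaoa_mul_prod (γ β : ℝ) (χ : V → ℤˣ → ℂ) :
    ∑ z, ((‖qaoaAmplitude G γ β z‖ ^ 2 : ℝ) : ℂ) * ∏ i, χ i (z i) =
      ∑ y, ∑ y', (∏ i, mixerConj β (χ i) (y i) (y' i)) *
        (phaseAmplitude G γ y * conj (phaseAmplitude G γ y')) := by
  have h1 : ∀ z, ((‖qaoaAmplitude G γ β z‖ ^ 2 : ℝ) : ℂ) * ∏ i, χ i (z i) =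
      ∑ y, ∑ y', (∏ i, χ i (z i) * (mixerEntry β (z i) (y i) * conj (mixerEntry β (z i) (y' i)))) *
        (phaseAmplitude G γ y * conj (phaseAmplitude G γ y')) := by
    intro z
    have h2 : qaoaAmplitude G γ β z =
      ∑ y, (∏ i, mixerEntry β (z i) (y i)) * phaseAmplitude G γ y := rfl
    rw [Complex.ofReal_pow, ← Complex.mul_conj', h2, map_sum, Finset.sum_mul_sum, Finset.sum_mul]
    refine Finset.sum_congr rfl fun y _ => ?_
    rw [Finset.sum_mul]
    refine Finset.sum_congr rfl fun y' _ => ?_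
    rw [map_mul, map_prod, Finset.prod_mul_distrib, Finset.prod_mul_distrib]
    ring
  simp only [h1]
  rw [Finset.sum_comm]
  refine Finset.sum_congr rfl fun y _ => ?_
  rw [Finset.sum_comm]
  refine Finset.sum_congr rfl fun y' _ => ?_
  rw [← Finset.sum_mul]
  congr 1
  simp only [mixerConj]
  rw [Finset.prod_univ_sum, Fintype.piFinset_univ]

theorem sum_qaoa (γ β : ℝ) : ∑ z, ‖qaoaAmplitude G γ β z‖ ^ 2 = 1 := by
  have h := sum_qaoa_mul_prod G γ β (fun _ _ => 1)
  simp only [Finset.prod_const_one, mul_one, mixerConj_one] at h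
  have h2 : ∀ y y' : V → ℤˣ, (∏ i, if y i = y' i then (1 : ℂ) else 0) = if y' = y then 1 else 0 := by
    intro y y'
    rw [Fintype.prod_boole]
    simp only [funext_iff, eq_comm]
  simp only [h2, ite_mul, one_mul, zero_mul, Finset.sum_ite_eq', Finset.mem_univ, if_true,
    phaseAmplitude_mul_conj, sub_self, Complex.ofReal_zero, mul_zero, Complex.exp_zero, mul_one,
    Finset.sum_const, Finset.card_univ, Fintype.card_fun, Fintype.card_units_int, nsmul_eq_mul] at h
  rw [Nat.cast_pow, Nat.cast_ofNat, mul_one_div_cancel (pow_ne_zero _ two_ne_zero)] at h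
  exact_mod_cast h

theorem prodMean_prod_subset {S R : Type*} [Fintype S] [CommSemiring R] {p : S → R}
    (hp : ∑ s, p s = 1) (A : Finset V) (f : S → R) :
    prodMean p (fun y : V → S => ∏ i ∈ A, f (y i)) = (∑ s, p s * f s) ^ A.card := by
  have h : ∀ y : V → S, ∏ i ∈ A, f (y i) = ∏ i, (if i ∈ A then f (y i) else 1) := by
    intro y
    rw [Finset.prod_ite_mem, Finset.univ_inter]
  simp only [h]
  rw [prodMean_prod (fun i s => if i ∈ A then f s else 1)]
  have h' : ∀ i, ∑ s, p s * (if i ∈ A then f s else 1) = if i ∈ A then ∑ s, p s * f s else 1 := by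
    intro i
    split_ifs <;> simp [hp]
  simp only [h']
  rw [Finset.prod_ite_mem, Finset.univ_inter, Finset.prod_const]

/-- The kernel is the identity at every vertex other than `a` and `b`, so `y'` can differ from `y`
only there. -/
theorem sum_pair_mul_eq {a b : V} (hne : a ≠ b) (K : ℤˣ → ℤˣ → ℂ) (y : V → ℤˣ)
    (H : (V → ℤˣ) → ℂ) :
    ∑ y' : V → ℤˣ, (∏ i, if i = a ∨ i = b then K (y i) (y' i) else if y i = y' i then 1 else 0) *
      H y' = ∑ x : ℤˣ × ℤˣ, K (y a) x.1 * K (y b) x.2 * H (update (update y a x.1) b x.2) := by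
  refine (Fintype.sum_of_injective (fun x : ℤˣ × ℤˣ => update (update y a x.1) b x.2) ?_ _ _ ?_
    ?_).symm
  · rintro ⟨s, t⟩ ⟨s', t'⟩ h
    have h1 := congrFun h a
    have h2 := congrFun h b
    simp only [update_self, update_of_ne hne] at h1 h2
    rw [h1, h2]
  · intro y' hy'
    have : ∃ i, ¬ (i = a ∨ i = b) ∧ y i ≠ y' i := by
      by_contra! hcon
      refine hy' ⟨(y' a, y' b), funext fun i => ?_⟩
      by_cases hb : i = b
      · subst hb; simp
      · by_cases ha : i = a
        · subst ha; simp [update_of_ne hb]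
        · simp only [update_of_ne hb, update_of_ne ha]
          exact hcon i (by tauto)
    obtain ⟨i, hi, hi'⟩ := this
    rw [Finset.prod_eq_zero (Finset.mem_univ i) (by simp [hi, hi']), zero_mul]
  · rintro ⟨s, t⟩
    congr 1
    have h : ∀ i, (if i = a ∨ i = b then K (y i) (update (update y a s) b t i) else
        if y i = update (update y a s) b t i then 1 else 0) =
        if i = a ∨ i = b then K (y i) (update (update y a s) b t i) else 1 := by
      intro i
      split_ifs with h1 h2 <;> try rfl
      push Not at h1
      exact absurd (by rw [update_of_ne h1.2, update_of_ne h1.1]) h2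
    simp only [h]
    rw [← Finset.prod_filter]
    have : univ.filter (fun i => i = a ∨ i = b) = {a, b} := by ext; simp
    rw [this, Finset.prod_pair hne, update_self, update_of_ne hne, update_self]

theorem prodMean_sum_mul {S R X : Type*} [Fintype S] [CommSemiring R] [Fintype X] (p : S → R)
    (c : X → R) (F : X → (V → S) → R) :
    prodMean p (fun y => ∑ x, c x * F x y) = ∑ x, c x * prodMean p (F x) := by
  simp only [prodMean, Finset.mul_sum]
  rw [Finset.sum_comm]
  exact Finset.sum_congr rfl fun x _ => Finset.sum_congr rfl fun y _ => by ring

/-- The exponential splits over the vertices of two disjoint sets, and each uniform spin averages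
its phase to a cosine. -/
theorem prodMean_exp (γ : ℝ) {D : ℕ} (htri : G.CliqueFree 3) (hreg : G.IsRegularOfDegree D)
    {a b : V} (hab : G.Adj a b) (c x x' : ℝ) :
    prodMean (fun _ : ℤˣ => (1 / 2 : ℂ)) (fun y : V → ℤˣ =>
      Complex.exp (Complex.I * γ * ((c + x * ∑ j ∈ (G.neighborFinset a).erase b, spinVal (y j) +
        x' * ∑ j ∈ (G.neighborFinset b).erase a, spinVal (y j) : ℝ) : ℂ))) =
      Complex.exp (Complex.I * γ * c) *
        (Complex.cos (γ * x) ^ (D - 1) * Complex.cos (γ * x') ^ (D - 1)) := by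
  have hp : ∑ _s : ℤˣ, (1 / 2 : ℂ) = 1 := by simp
  have hsplit : ∀ y : V → ℤˣ,
      Complex.exp (Complex.I * γ * ((c + x * ∑ j ∈ (G.neighborFinset a).erase b, spinVal (y j) +
        x' * ∑ j ∈ (G.neighborFinset b).erase a, spinVal (y j) : ℝ) : ℂ)) =
      Complex.exp (Complex.I * γ * c) *
        ((∏ j ∈ (G.neighborFinset a).erase b, Complex.exp (Complex.I * γ * x * spinVal (y j))) *
        ∏ j ∈ (G.neighborFinset b).erase a, Complex.exp (Complex.I * γ * x' * spinVal (y j))) := by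
    intro y
    rw [← Complex.exp_sum, ← Complex.exp_sum, ← Complex.exp_add, ← Complex.exp_add]
    congr 1
    rw [← Finset.mul_sum, ← Finset.mul_sum]
    push_cast
    ring
  have hcos : ∀ x : ℝ, ∑ s : ℤˣ, (1 / 2 : ℂ) * Complex.exp (Complex.I * γ * x * spinVal s) =
      Complex.cos (γ * x) := by
    intro x
    rw [sum_units, Complex.cos]
    norm_num [spinVal]
    ring_nf
  have hpull : ∀ (c : ℂ) (F : (V → ℤˣ) → ℂ), prodMean (fun _ : ℤˣ => (1 / 2 : ℂ))
      (fun y => c * F y) = c * prodMean (fun _ : ℤˣ => (1 / 2 : ℂ)) F := by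
    intro c F
    simpa using prodMean_sum_mul (X := Unit) (fun _ : ℤˣ => (1 / 2 : ℂ)) (fun _ => c) (fun _ => F)
  simp only [hsplit]
  rw [hpull, prodMean_mul_of_disjoint hp (disjoint_neighborFinset_erase G htri hab)
    (F := fun y => ∏ j ∈ (G.neighborFinset a).erase b,
      Complex.exp (Complex.I * γ * x * spinVal (y j)))
    (H := fun y => ∏ j ∈ (G.neighborFinset b).erase a,
      Complex.exp (Complex.I * γ * x' * spinVal (y j))),
    prodMean_prod_subset hp _ (fun s => Complex.exp (Complex.I * γ * x * spinVal s)),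
    prodMean_prod_subset hp _ (fun s => Complex.exp (Complex.I * γ * x' * spinVal s)),
    hcos, hcos, card_neighborFinset_erase G hreg hab, card_neighborFinset_erase G hreg hab.symm]
  · intro y y' h
    exact Finset.prod_congr rfl fun i hi => by rw [h i hi]
  · intro y y' h
    exact Finset.prod_congr rfl fun i hi => by rw [h i hi]

/-- Let s, t be the spins of `y` at a, b. If `y'` differs from `y` at neither or both endpoints, the
phase is trivial at the edge ab and the term is odd in s, so it averages to 0. If it differs at
exactly one, the edge contributes exp(iγst), whose mean against st is i sin γ, and the other D - 1
edges at that endpoint contribute cos^(D-1) γ. The two such cases combine sin 2β cos 2β into sin 4β.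
-/
theorem sum_qaoa_mul_spins (γ β : ℝ) {D : ℕ} (htri : G.CliqueFree 3)
    (hreg : G.IsRegularOfDegree D) {a b : V} (hab : G.Adj a b) :
    ∑ z, ‖qaoaAmplitude G γ β z‖ ^ 2 * (spinVal (z a) * spinVal (z b)) =
      -(Real.sin (4 * β) * (Real.sin γ * Real.cos γ ^ (D - 1))) := by
  have hne : a ≠ b := hab.ne
  have hp : ∑ _s : ℤˣ, (1 / 2 : ℂ) = 1 := by simp
  have h1 : ∀ z : V → ℤˣ, ((spinVal (z a) * spinVal (z b) : ℝ) : ℂ) =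
      ∏ i, (if i = a ∨ i = b then (spinVal (z i) : ℂ) else 1) := by
    intro z
    rw [← Finset.prod_filter]
    have : univ.filter (fun i => i = a ∨ i = b) = {a, b} := by ext; simp
    rw [this, Finset.prod_pair hne, Complex.ofReal_mul]
  have h2 : ∀ i (s t : ℤˣ), mixerConj β (fun s => if i = a ∨ i = b then (spinVal s : ℂ) else 1) s t =
      if i = a ∨ i = b then mixerConj β (fun s => (spinVal s : ℂ)) s t
      else if s = t then 1 else 0 := by
    intro i s t
    split_ifs with hi hst <;> simp [mixerConj_one, *]
  have h3 : ((∑ z, ‖qaoaAmplitude G γ β z‖ ^ 2 * (spinVal (z a) * spinVal (z b)) : ℝ) : ℂ) =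
      prodMean (fun _ : ℤˣ => (1 / 2 : ℂ)) (fun y : V → ℤˣ => ∑ x : ℤˣ × ℤˣ,
        mixerConj β (fun s => (spinVal s : ℂ)) (y a) x.1 *
        mixerConj β (fun s => (spinVal s : ℂ)) (y b) x.2 *
        Complex.exp (Complex.I * γ * ((cutSize G (update (update y a x.1) b x.2) : ℝ) -
          (cutSize G y : ℝ) : ℝ))) := by
    rw [Complex.ofReal_sum]
    simp only [Complex.ofReal_mul (_ ^ 2), h1]
    rw [sum_qaoa_mul_prod G γ β (fun i s => if i = a ∨ i = b then (spinVal s : ℂ) else 1)]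
    simp only [h2]
    refine Finset.sum_congr rfl fun y _ => ?_
    rw [sum_pair_mul_eq hne, Finset.mul_sum]
    refine Finset.sum_congr rfl fun x _ => ?_
    rw [phaseAmplitude_mul_conj, Finset.prod_const, Finset.card_univ, one_div_pow]
    ring
  have h4 : ∀ s t : ℤˣ, prodMean (fun _ : ℤˣ => (1 / 2 : ℂ)) (fun y : V → ℤˣ => ∑ x : ℤˣ × ℤˣ,
        mixerConj β (fun s => (spinVal s : ℂ)) (update (update y b t) a s a) x.1 *
        mixerConj β (fun s => (spinVal s : ℂ)) (update (update y b t) a s b) x.2 *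
        Complex.exp (Complex.I * γ *
          ((cutSize G (update (update (update (update y b t) a s) a x.1) b x.2) : ℝ) -
          (cutSize G (update (update y b t) a s) : ℝ) : ℝ))) =
      ∑ x : ℤˣ × ℤˣ, mixerConj β (fun s => (spinVal s : ℂ)) s x.1 *
        mixerConj β (fun s => (spinVal s : ℂ)) t x.2 *
        (Complex.exp (Complex.I * γ * ((1 / 2 * (spinVal s * spinVal t -
            spinVal x.1 * spinVal x.2) : ℝ) : ℂ)) *
          (Complex.cos (γ * ((1 / 2 * (spinVal s - spinVal x.1) : ℝ) : ℂ)) ^ (D - 1) *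
          Complex.cos (γ * ((1 / 2 * (spinVal t - spinVal x.2) : ℝ) : ℂ)) ^ (D - 1))) := by
    intro s t
    simp only [cutSize_update_update G hab, add_sub_cancel_left, update_self,
      update_of_ne hne.symm]
    rw [prodMean_sum_mul]
    refine Finset.sum_congr rfl fun x _ => ?_
    rw [prodMean_exp G γ htri hreg hab]
  apply Complex.ofReal_injective
  have h5 : ∀ s : ℤˣ, prodMean (fun _ : ℤˣ => (1 / 2 : ℂ)) (fun y : V → ℤˣ => ∑ x : ℤˣ × ℤˣ,
        mixerConj β (fun s => (spinVal s : ℂ)) (update y a s a) x.1 *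
        mixerConj β (fun s => (spinVal s : ℂ)) (update y a s b) x.2 *
        Complex.exp (Complex.I * γ *
          ((cutSize G (update (update (update y a s) a x.1) b x.2) : ℝ) -
          (cutSize G (update y a s) : ℝ) : ℝ))) = ∑ t, 1 / 2 * _ := fun s =>
    (prodMean_resample hp b _).trans (Finset.sum_congr rfl fun t _ => by rw [h4 s t])
  rw [h3, prodMean_resample hp a]
  simp only [h5]
  simp only [mixerConj_spin, Fintype.sum_prod_type, sum_units]
  have hs : spinVal 1 = 1 := by simp [spinVal]
  have hs' : spinVal (-1) = -1 := by simp [spinVal]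
  have hu : (1 : ℤˣ) ≠ -1 := by decide
  simp only [hs, hs', hu, hu.symm, if_true, if_false]
  norm_num
  have he : Complex.exp (Complex.I * γ) = Complex.cos γ + Complex.sin γ * Complex.I := by
    rw [mul_comm, Complex.exp_mul_I]
  have he' : Complex.exp (-(Complex.I * γ)) = Complex.cos γ - Complex.sin γ * Complex.I := by
    rw [show -(Complex.I * (γ : ℂ)) = (-γ : ℂ) * Complex.I by ring, Complex.exp_mul_I,
      Complex.cos_neg, Complex.sin_neg]
    ring
  have hsin : Complex.sin (4 * β) = 2 * Complex.sin (2 * β) * Complex.cos (2 * β) := by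
    rw [← Complex.sin_two_mul]
    ring_nf
  rw [he, he', hsin]
  linear_combination 2 * Complex.sin (2 * β) * Complex.cos (2 * β) * Complex.sin γ *
    Complex.cos γ ^ (D - 1) * Complex.I_sq

theorem qaoaCutFraction_eq [Nonempty V] (γ β : ℝ) {D : ℕ} (hD : 1 ≤ D) (htri : G.CliqueFree 3)
    (hreg : G.IsRegularOfDegree D) :
    qaoaCutFraction G γ β =
      1 / 2 + 1 / 2 * (Real.sin (4 * β) * (Real.sin γ * Real.cos γ ^ (D - 1))) := by
  rw [qaoaCutFraction, sum_mul_cutFraction G (edgeFinset_card_pos G hD hreg) _ (sum_qaoa G γ β) _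
    fun _ _ hab => sum_qaoa_mul_spins G γ β htri hreg hab]
  ring

end QAOA

/-! ### Optimising the QAOA angles -/

theorem succ_mul_pow_sub_le_one (N : ℕ) {y : ℝ} (hy : 0 ≤ y) :
    (N + 1) * y ^ N - N * y ^ (N + 1) ≤ 1 := by
  induction N with
  | zero => simp
  | succ N ih =>
    -- Passing from N to N + 1 lowers the left side by exactly this nonnegative term, which vanishes
    -- at the maximiser y = 1.
    have h : 0 ≤ (N + 1) * y ^ N * (y - 1) ^ 2 := by positivity
    push_cast
    have h' : ((N : ℝ) + 1 + 1) * y ^ (N + 1) - (N + 1) * y ^ (N + 1 + 1) =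
        (N + 1) * y ^ N - N * y ^ (N + 1) - (N + 1) * y ^ N * (y - 1) ^ 2 := by ring
    linarith

/-- The gain of the optimal one-step QAOA over a random cut, as the square root of a rational. -/
theorem qaoaValue_succ (N : ℕ) :
    qaoaValue (N + 1) =
      1 / 2 + 1 / 2 * Real.sqrt ((N : ℝ) ^ N / ((N + 1 : ℝ) ^ (N + 1))) := by
  have hN : (0 : ℝ) ≤ N / (N + 1) := by positivity
  have h1 : (1 : ℝ) - 1 / (N + 1) = N / (N + 1) := by field_simp; ring
  have h2 : ((N : ℝ) / (N + 1)) ^ ((N : ℝ) / 2) = Real.sqrt ((N / (N + 1)) ^ N) := by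
    rw [Real.sqrt_eq_rpow, ← Real.rpow_natCast, ← Real.rpow_mul hN]
    ring_nf
  rw [qaoaValue]
  push_cast
  have h3 : (N : ℝ) ^ N / (N + 1) ^ (N + 1) = (N / (N + 1)) ^ N / (N + 1) := by
    rw [div_pow, pow_succ, div_div]
  rw [h1, add_sub_cancel_right, h2, h3, Real.sqrt_div (by positivity)]
  field_simp

theorem sin_mul_cos_pow_sq_le (N : ℕ) (γ : ℝ) :
    (Real.sin γ * Real.cos γ ^ N) ^ 2 ≤ (N : ℝ) ^ N / ((N + 1 : ℝ) ^ (N + 1)) := by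
  rcases Nat.eq_zero_or_pos N with rfl | hN
  · simpa using Real.sin_sq_le_one γ
  have hN' : (0 : ℝ) < N := by exact_mod_cast hN
  set x := Real.cos γ ^ 2 with hx
  have hx0 : 0 ≤ x := sq_nonneg _
  -- The function (1 - x) x^N peaks at x = N/(N+1); the rescaling moves this point to y = 1.
  have h := succ_mul_pow_sub_le_one N (y := x * (N + 1) / N) (by positivity)
  have h1 : (Real.sin γ * Real.cos γ ^ N) ^ 2 = (1 - x) * x ^ N := by
    rw [mul_pow, Real.sin_sq, ← pow_mul, mul_comm N 2, pow_mul]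
  rw [h1, le_div_iff₀ (by positivity)]
  have h2 : (N + 1) * (x * (N + 1) / N) ^ N - N * (x * (N + 1) / N) ^ (N + 1) =
      (1 - x) * x ^ N * (N + 1 : ℝ) ^ (N + 1) / (N : ℝ) ^ N := by
    rw [div_pow, div_pow, mul_pow, mul_pow]
    field_simp
    ring
  rw [h2, div_le_one (by positivity)] at h
  exact h

theorem isGreatest_qaoa {D : ℕ} (hD : 1 ≤ D) {V : Type u} [Fintype V] [DecidableEq V] [Nonempty V]
    (G : SimpleGraph V) [DecidableRel G.Adj] (htri : G.CliqueFree 3)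
    (hreg : G.IsRegularOfDegree D) :
    IsGreatest (Set.range fun p : ℝ × ℝ => qaoaCutFraction G p.1 p.2) (qaoaValue D) := by
  obtain ⟨N, rfl⟩ : ∃ N, D = N + 1 := ⟨D - 1, by omega⟩
  simp only [qaoaCutFraction_eq G _ _ hD htri hreg, Nat.add_sub_cancel]
  rw [qaoaValue_succ]
  constructor
  -- The optimum has sin 4β = 1 and sin² γ = 1/D.
  · refine ⟨(Real.arcsin (1 / Real.sqrt (N + 1)), Real.pi / 8), ?_⟩
    have h1 : (1 : ℝ) ≤ Real.sqrt (N + 1) := Real.one_le_sqrt.2 (by simp)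
    have h2 : 1 / Real.sqrt (N + 1) ≤ 1 := (div_le_one (by positivity)).2 h1
    have h3 : 0 ≤ 1 / Real.sqrt (N + 1) := by positivity
    have h4 : (1 : ℝ) - (1 / Real.sqrt (N + 1)) ^ 2 = N / (N + 1) := by
      rw [div_pow, Real.sq_sqrt (by positivity)]
      field_simp
      ring
    have h5 : Real.sin (4 * (Real.pi / 8)) = 1 := by
      rw [show 4 * (Real.pi / 8) = Real.pi / 2 by ring, Real.sin_pi_div_two]
    simp only [h5]
    rw [Real.sin_arcsin (by linarith) h2, Real.cos_arcsin, h4]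
    congr 2
    rw [eq_comm, Real.sqrt_eq_iff_mul_self_eq (by positivity) (by positivity)]
    have h6 : Real.sqrt (N / (N + 1)) ^ N * Real.sqrt (N / (N + 1)) ^ N =
        (N : ℝ) ^ N / (N + 1 : ℝ) ^ N := by
      rw [← mul_pow, Real.mul_self_sqrt (by positivity), div_pow]
    have h7 : (1 / Real.sqrt (N + 1)) * (1 / Real.sqrt (N + 1)) = 1 / (N + 1 : ℝ) := by
      rw [div_mul_div_comm, Real.mul_self_sqrt (by positivity), one_mul]
    rw [one_mul, mul_mul_mul_comm, h6, h7, pow_succ]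
    field_simp
  · rintro _ ⟨⟨γ, β⟩, rfl⟩
    have h : |Real.sin γ * Real.cos γ ^ N| ≤
        Real.sqrt ((N : ℝ) ^ N / ((N + 1 : ℝ) ^ (N + 1))) :=
      Real.abs_le_sqrt (sin_mul_cos_pow_sq_le N γ)
    have h' : Real.sin (4 * β) * (Real.sin γ * Real.cos γ ^ N) ≤
        |Real.sin γ * Real.cos γ ^ N| := by
      refine (le_abs_self _).trans ?_
      rw [abs_mul]
      exact mul_le_of_le_one_left (abs_nonneg _) (Real.abs_sin_le_one _)
    simp only
    linarith

/-! ### Degrees 2, 3, 4, 6 and 11 -/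

theorem qaoaValue_succ_lt {N : ℕ} {x : ℝ} (hx : 0 < x)
    (h : (N : ℝ) ^ N / (N + 1 : ℝ) ^ (N + 1) < (2 * x) ^ 2) : qaoaValue (N + 1) < 1 / 2 + x := by
  have h' := (Real.sqrt_lt' (by linarith : (0 : ℝ) < 2 * x)).2 h
  rw [qaoaValue_succ]
  linarith

theorem lt_qaoaValue_succ {N : ℕ} {x : ℝ}
    (h : (2 * x) ^ 2 < (N : ℝ) ^ N / (N + 1 : ℝ) ^ (N + 1)) : 1 / 2 + x < qaoaValue (N + 1) := by
  have h' := Real.lt_sqrt_of_sq_lt h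
  rw [qaoaValue_succ]
  linarith

theorem softThreshold_beatsQAOA {N : ℕ} {q : ℕ → ℝ} (hq : ∀ m, q m ∈ Set.Icc (-1 : ℝ) 1)
    (hpos : 0 < softThresholdImprovement (N + 1) q)
    (h : (N : ℝ) ^ N / (N + 1 : ℝ) ^ (N + 1) < (2 * softThresholdImprovement (N + 1) q) ^ 2) :
    BeatsQAOA.{u} (softThreshold q hq) (N + 1) := by
  intro V _ _ _ G _ htri hreg
  rw [softThreshold_expectedCutFraction q hq (Nat.le_add_left 1 N) G htri hreg]
  exact qaoaValue_succ_lt hpos h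

theorem softRuleSix_beatsQAOA : BeatsQAOA.{u} (softThreshold softRuleSix softRuleSix_mem) 6 := by
  have h : softThresholdImprovement (5 + 1) softRuleSix = 2133 / 16384 := by
    norm_num [softThresholdImprovement, Finset.sum_range_succ, softRuleSix, Nat.choose]
  exact softThreshold_beatsQAOA (N := 5) _ (by rw [h]; norm_num) (by rw [h]; norm_num)

theorem softRuleEleven_beatsQAOA :
    BeatsQAOA.{u} (softThreshold softRuleEleven softRuleEleven_mem) 11 := by
  have h : softThresholdImprovement (10 + 1) softRuleEleven = 413919 / 4194304 := by
    norm_num [softThresholdImprovement, Finset.sum_range_succ, softRuleEleven, Nat.choose]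
  exact softThreshold_beatsQAOA (N := 10) _ (by rw [h]; norm_num) (by rw [h]; norm_num)

/-- Such a threshold is never reached, so no spin flips and the cut stays random. This leaves
finitely many thresholds per degree. -/
theorem softThresholdImprovement_thresholdRule_of_lt {D τ : ℕ} (h : D < τ) :
    softThresholdImprovement D (thresholdRule τ) = 0 := by
  have h' : ∀ n ∈ range D, ((D - 1).choose n : ℝ) / 2 ^ (D - 1) * thresholdRule τ n =
      ((D - 1).choose n : ℝ) / 2 ^ (D - 1) * thresholdRule τ (n + 1) := by
    intro n hn
    rw [Finset.mem_range] at hn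
    rw [thresholdRule, thresholdRule, if_neg (by omega), if_neg (by omega)]
  rw [softThresholdImprovement, Finset.sum_congr rfl h', sub_self, mul_zero]

theorem thresholdRule_improvement_sq_lt {N : ℕ} (hN : N ∈ ({2, 3, 5, 10} : Finset ℕ)) (τ : ℕ) :
    (2 * softThresholdImprovement (N + 1) (thresholdRule τ)) ^ 2 <
      (N : ℝ) ^ N / (N + 1 : ℝ) ^ (N + 1) := by
  rcases le_or_gt τ (N + 1) with h | h
  · simp only [Finset.mem_insert, Finset.mem_singleton] at hN
    rcases hN with rfl | rfl | rfl | rfl <;> interval_cases τ <;>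
      norm_num [softThresholdImprovement, Finset.sum_range_succ, thresholdRule, Nat.choose]
  · rw [softThresholdImprovement_thresholdRule_of_lt h]
    simp only [Finset.mem_insert, Finset.mem_singleton] at hN
    rcases hN with rfl | rfl | rfl | rfl <;> norm_num

theorem threshold_lt_qaoaValue {D : ℕ} (hD : D ∈ ({3, 4, 6, 11} : Set ℕ)) (τ : ℕ) :
    ForAllTriangleFreeRegular.{u} D fun _ _ _ G _ =>
      (thresholdAlgorithm τ).expectedCutFraction G < qaoaValue D := by
  intro V _ _ _ G _ htri hreg
  obtain ⟨N, rfl, hN⟩ : ∃ N, D = N + 1 ∧ N ∈ ({2, 3, 5, 10} : Finset ℕ) := by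
    rcases hD with rfl | rfl | rfl | rfl
    exacts [⟨2, rfl, by simp⟩, ⟨3, rfl, by simp⟩, ⟨5, rfl, by simp⟩, ⟨10, rfl, by simp⟩]
  rw [thresholdAlgorithm, softThreshold_expectedCutFraction _ _ (Nat.le_add_left 1 N) G htri hreg]
  exact lt_qaoaValue_succ (thresholdRule_improvement_sq_lt hN τ)

theorem qaoaValue_two : qaoaValue 2 = 3 / 4 := by
  rw [qaoaValue_succ 1, show ((1 : ℕ) : ℝ) ^ 1 / (((1 : ℕ) : ℝ) + 1) ^ (1 + 1) = (1 / 2) ^ 2 by norm_num,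
    Real.sqrt_sq (by norm_num)]
  norm_num

theorem softThresholdImprovement_two (q : ℕ → ℝ) :
    softThresholdImprovement 2 q = 1 / 16 * ((q 0 + q 1) ^ 2 - (q 1 + q 2) ^ 2) := by
  change softThresholdImprovement (1 + 1) q = _
  simp only [softThresholdImprovement, Finset.sum_range_succ, Finset.sum_range_zero]
  norm_num
  ring

theorem threshold_two_le_qaoaValue (τ : ℕ) : ForAllTriangleFreeRegular.{u} 2 fun _ _ _ G _ =>
    (thresholdAlgorithm τ).expectedCutFraction G ≤ qaoaValue 2 := by
  intro V _ _ _ G _ htri hreg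
  rw [thresholdAlgorithm, softThreshold_expectedCutFraction _ _ one_le_two G htri hreg,
    qaoaValue_two]
  rcases le_or_gt τ 2 with h | h
  · interval_cases τ <;>
      norm_num [softThresholdImprovement_two, thresholdRule]
  · rw [softThresholdImprovement_thresholdRule_of_lt h]
    norm_num

theorem threshold_two_eq_qaoaValue : ForAllTriangleFreeRegular.{u} 2 fun _ _ _ G _ =>
    (thresholdAlgorithm 2).expectedCutFraction G = qaoaValue 2 := by
  intro V _ _ _ G _ htri hreg
  rw [thresholdAlgorithm, softThreshold_expectedCutFraction _ _ one_le_two G htri hreg,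
    qaoaValue_two]
  norm_num [softThresholdImprovement_two, thresholdRule]

/-! ### The four-valued tensor algorithm in degrees 3 and 4 -/

/-- The sum of the signs of `(x - 599 (w₁ + ⋯ + w_k)) / 3000` over all `w ∈ {-3, -1, 1, 3}ᵏ`. -/
def signSum : ℕ → ℤ → ℤ
  | 0, x => x.sign
  | k + 1, x => signSum k (x + 1797) + signSum k (x + 599) + signSum k (x - 599) +
      signSum k (x - 1797)

/-- Entries are multiples of 1/3 and c = 599/1000, so in units of 1/3000 all signs are signs of
integers. The shifts 599 and 1797 are c times 1/3 and c times 1. -/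
theorem fourValuedTensor_iidMean (k : ℕ) (x : ℤ) :
    iidMean (fun _ : Fin 4 => (1 / 4 : ℝ)) k (fun N => Real.sign ((x : ℝ) / 3000 +
      599 / 1000 * -(N.map (![-1, -(1 / 3), 1 / 3, 1] : Fin 4 → ℝ)).sum)) = signSum k x / 4 ^ k := by
  induction k generalizing x with
  | zero =>
    simp only [iidMean, signSum, Multiset.map_zero, Multiset.sum_zero, neg_zero, mul_zero, add_zero,
      pow_zero, div_one]
    rcases lt_trichotomy x 0 with h | rfl | h
    · rw [Int.sign_eq_neg_one_of_neg h, Real.sign_of_neg (by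
        have : (x : ℝ) < 0 := by exact_mod_cast h
        linarith)]
      simp
    · simp
    · rw [Int.sign_eq_one_of_pos h, Real.sign_of_pos (by positivity)]
      simp
  | succ k ih =>
    simp only [iidMean, signSum, Fin.sum_univ_four, Multiset.map_cons, Multiset.sum_cons]
    have h : ∀ (a : ℝ) (z : ℤ), (x : ℝ) / 3000 - 599 / 1000 * a = (z : ℝ) / 3000 →
        iidMean (fun _ : Fin 4 => (1 / 4 : ℝ)) k (fun N => Real.sign ((x : ℝ) / 3000 +
          599 / 1000 * -(a + (N.map (![-1, -(1 / 3), 1 / 3, 1] : Fin 4 → ℝ)).sum))) =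
        signSum k z / 4 ^ k := by
      intro a z hz
      rw [← ih z, ← hz]
      congr 1
      funext N
      congr 1
      ring
    rw [h _ (x + 1797) (by push_cast; norm_num; ring), h _ (x + 599) (by push_cast; norm_num; ring),
      h _ (x - 599) (by push_cast; norm_num; ring), h _ (x - 1797) (by push_cast; norm_num; ring)]
    push_cast
    ring

/-- The initial entries of the four-valued tensor algorithm in units of `1 / 3`. -/
def fourValue : Fin 4 → ℤ := ![-3, -1, 1, 3]

theorem fourValuedTensor_pairMean (k : ℕ) (s t : Fin 4) :
    (fourValuedTensor (599 / 1000)).toLocal.pairMean (k + 1) s t =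
      signSum k (1000 * fourValue s - 599 * fourValue t) / 4 ^ k := by
  rw [← fourValuedTensor_iidMean]
  have hv : ∀ s : Fin 4, (![-1, -(1 / 3), 1 / 3, 1] : Fin 4 → ℝ) s = (fourValue s : ℝ) / 3 := by
    intro s
    fin_cases s <;> norm_num [fourValue]
  change iidMean (fun _ : Fin 4 => (1 / 4 : ℝ)) k (fun N => Real.sign
    ((![-1, -(1 / 3), 1 / 3, 1] : Fin 4 → ℝ) s +
      599 / 1000 * -((t ::ₘ N).map (![-1, -(1 / 3), 1 / 3, 1] : Fin 4 → ℝ)).sum)) = _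
  congr 1
  funext N
  rw [Multiset.map_cons, Multiset.sum_cons, hv s, hv t]
  congr 1
  push_cast
  ring

/-- The edge correlation is -K / 4^(2k+2): a factor 4^2 comes from the states of the endpoints and
4^k from the other neighbours of each. -/
theorem fourValuedTensor_beatsQAOA {k : ℕ} {K : ℤ}
    (hK : ∑ s, ∑ t, signSum k (1000 * fourValue s - 599 * fourValue t) *
      signSum k (1000 * fourValue t - 599 * fourValue s) = -K) (hpos : 0 < K)
    (h : (k : ℝ) ^ k / (k + 1 : ℝ) ^ (k + 1) < ((K : ℝ) / 4 ^ (2 * k + 2)) ^ 2) :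
    BeatsQAOA.{u} (fourValuedTensor (599 / 1000)).toLocal (k + 1) := by
  intro V _ _ _ G _ htri hreg
  rw [LocalAlgorithm.expectedCutFraction_eq _ G (Nat.le_add_left 1 k) htri hreg]
  have hsum : ∑ s : Fin 4, ∑ t : Fin 4, (1 / 4 : ℝ) * (1 / 4) *
      ((fourValuedTensor (599 / 1000)).toLocal.pairMean (k + 1) s t *
      (fourValuedTensor (599 / 1000)).toLocal.pairMean (k + 1) t s) = -(K : ℝ) / 4 ^ (2 * k + 2) := by
    rw [← Int.cast_neg, ← hK]
    push_cast
    simp only [fourValuedTensor_pairMean, Finset.sum_div]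
    refine Finset.sum_congr rfl fun s _ => Finset.sum_congr rfl fun t _ => ?_
    rw [pow_add, pow_mul', sq]
    field_simp
  have hK' : (0 : ℝ) < K := by exact_mod_cast hpos
  have key := qaoaValue_succ_lt (N := k) (x := (K : ℝ) / 4 ^ (2 * k + 2) / 2) (by positivity)
    (by rwa [mul_div_cancel₀ _ two_ne_zero])
  refine key.trans_eq ?_
  change _ = (1 - ∑ s : Fin 4, ∑ t : Fin 4, (1 / 4 : ℝ) * (1 / 4) *
      ((fourValuedTensor (599 / 1000)).toLocal.pairMean (k + 1) s t *
      (fourValuedTensor (599 / 1000)).toLocal.pairMean (k + 1) t s)) / 2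
  rw [hsum]
  ring

theorem fourValuedTensor_beatsQAOA_three :
    BeatsQAOA.{u} (fourValuedTensor (599 / 1000)).toLocal 3 :=
  fourValuedTensor_beatsQAOA (k := 2) (K := 1600) (by decide +kernel) (by norm_num) (by norm_num)

theorem fourValuedTensor_beatsQAOA_four :
    BeatsQAOA.{u} (fourValuedTensor (599 / 1000)).toLocal 4 :=
  fourValuedTensor_beatsQAOA (k := 3) (K := 21768) (by decide +kernel) (by norm_num) (by norm_num)

/-! ### Threshold algorithms up to degree 1000 -/

/-- By the symmetry of binomial coefficients the lower tail T cancels the upper one. The two signed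
sums are S + C and S - C with C = `N.choose j`, and their squares differ by 4CS. -/
theorem thresholdRule_improvement {N j : ℕ} (hj : 2 * j ≤ N) :
    softThresholdImprovement (N + 1) (thresholdRule (N - j + 1)) =
      (N.choose j : ℝ) * (∑ n ∈ Ioc j (N - j), N.choose n : ℕ) / 2 ^ (2 * N) := by
  set S : ℝ := ((∑ n ∈ Ioc j (N - j), N.choose n : ℕ) : ℝ) with hS
  set T : ℝ := ∑ n ∈ range j, (N.choose n : ℝ) with hT
  have hlow : ∑ n ∈ range (N - j + 1), (N.choose n : ℝ) = T + N.choose j + S := by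
    rw [hS, hT, ← Finset.sum_range_succ, Nat.cast_sum, Finset.range_eq_Ico, Finset.range_eq_Ico,
      ← Finset.Ico_add_one_add_one_eq_Ioc]
    exact (Finset.sum_Ico_consecutive _ (Nat.zero_le _) (by omega)).symm
  have hhigh : ∑ n ∈ Ico (N - j + 1) (N + 1), (N.choose n : ℝ) = T := by
    rw [hT, Finset.range_eq_Ico,
      Finset.sum_congr rfl (g := fun n => (N.choose (N - n) : ℝ)) fun n hn => by
        rw [Nat.choose_symm (by rw [Finset.mem_Ico] at hn; omega)]]
    rw [Finset.sum_Ico_reflect (fun n => (N.choose n : ℝ)) _ (le_refl _)]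
    rw [show N + 1 - (N + 1) = 0 by omega, show N + 1 - (N - j + 1) = j by omega]
  have hlow' : ∑ n ∈ range (N - j), (N.choose n : ℝ) = T + S := by
    have h := Finset.sum_range_succ (fun n => (N.choose n : ℝ)) (N - j)
    rw [hlow, Nat.choose_symm (by omega)] at h
    linarith
  have hhigh' : ∑ n ∈ Ico (N - j) (N + 1), (N.choose n : ℝ) = N.choose j + T := by
    rw [Finset.sum_eq_sum_Ico_succ_bot (by omega), hhigh, Nat.choose_symm (by omega)]
  have ha : ∑ n ∈ range (N + 1), (N.choose n : ℝ) * thresholdRule (N - j + 1) n =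
      N.choose j + S := by
    rw [Finset.range_eq_Ico, ← Finset.sum_Ico_consecutive _ (Nat.zero_le (N - j + 1)) (by omega),
      Finset.sum_congr rfl (g := fun n => (N.choose n : ℝ)) fun n hn => by
        rw [thresholdRule, if_neg (by rw [Finset.mem_Ico] at hn; omega), mul_one],
      ← Finset.range_eq_Ico, hlow,
      Finset.sum_congr rfl (s₁ := Ico (N - j + 1) (N + 1)) (g := fun n => -(N.choose n : ℝ))
        fun n hn => by
        rw [thresholdRule, if_pos (by rw [Finset.mem_Ico] at hn; omega), mul_neg_one],
      Finset.sum_neg_distrib, hhigh]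
    ring
  have hb : ∑ n ∈ range (N + 1), (N.choose n : ℝ) * thresholdRule (N - j + 1) (n + 1) =
      S - N.choose j := by
    rw [Finset.range_eq_Ico, ← Finset.sum_Ico_consecutive _ (Nat.zero_le (N - j)) (by omega),
      Finset.sum_congr rfl (g := fun n => (N.choose n : ℝ)) fun n hn => by
        rw [thresholdRule, if_neg (by rw [Finset.mem_Ico] at hn; omega), mul_one],
      ← Finset.range_eq_Ico, hlow',
      Finset.sum_congr rfl (s₁ := Ico (N - j) (N + 1)) (g := fun n => -(N.choose n : ℝ))
        fun n hn => by
        rw [thresholdRule, if_pos (by rw [Finset.mem_Ico] at hn; omega), mul_neg_one],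
      Finset.sum_neg_distrib, hhigh']
    ring
  simp only [softThresholdImprovement, Nat.add_sub_cancel, div_mul_eq_mul_div, ← Finset.sum_div,
    ha, hb]
  rw [mul_comm 2 N, pow_mul]
  field_simp
  ring

/-- `f n`, with `n` brought to the form of a numeral before `f` is unfolded in kernel reduction. -/
def evalThen {α : Type} (n : ℕ) (f : ℕ → α) : α :=
  match n with
  | 0 => f 0
  | m + 1 => f (m + 1)

theorem evalThen_eq {α : Type} (n : ℕ) (f : ℕ → α) : evalThen n f = f n := by
  cases n <;> rfl

/-- The sum of `N.choose m` over `n < m ≤ n + l`, computed from `c = N.choose n`. -/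
def chooseSum (N : ℕ) : ℕ → ℕ → ℕ → ℕ
  | 0, _, _ => 0
  | l + 1, n, c => evalThen (c * (N - n) / (n + 1)) fun c' =>
      evalThen (n + 1) fun n' => c' + chooseSum N l n' c'

theorem chooseSum_eq (N l n : ℕ) :
    chooseSum N l n (N.choose n) = ∑ m ∈ Ioc n (n + l), N.choose m := by
  induction l generalizing n with
  | zero => simp [chooseSum]
  | succ l ih =>
    -- The ratio of consecutive binomial coefficients; the natural-number division is exact.
    have h : N.choose n * (N - n) / (n + 1) = N.choose (n + 1) := by
      rw [← Nat.choose_succ_right_eq, Nat.mul_div_cancel _ (Nat.succ_pos n)]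
    rw [chooseSum, evalThen_eq, evalThen_eq, h, ih]
    rw [← Finset.Ico_add_one_add_one_eq_Ioc, ← Finset.Ico_add_one_add_one_eq_Ioc,
      Finset.sum_eq_sum_Ico_succ_bot (a := n + 1) (by omega)]
    congr 3
    omega

/-- Whether, in degree `N + 1`, the threshold `N - j + 1` beats the QAOA; here `c = N.choose j`. -/
def thresholdTest (N j c : ℕ) : Bool :=
  evalThen (c * chooseSum N (N - 2 * j) j c) fun x =>
    Nat.blt (N ^ N * 16 ^ N) (4 * x ^ 2 * (N + 1) ^ (N + 1))

/-- The improvement is x / 4^N, so clearing denominators in the squared comparison gives the integer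
inequality of the test. -/
theorem beatsQAOA_of_thresholdTest {N j : ℕ} (hj : 2 * j ≤ N)
    (h : thresholdTest N j (N.choose j) = true) :
    BeatsQAOA.{u} (thresholdAlgorithm (N - j + 1)) (N + 1) := by
  rw [thresholdTest, evalThen_eq, chooseSum_eq, show j + (N - 2 * j) = N - j by omega,
    Nat.blt_eq] at h
  have himp := thresholdRule_improvement hj
  set x := N.choose j * ∑ n ∈ Ioc j (N - j), N.choose n with hx
  rw [← Nat.cast_mul, ← hx] at himp
  -- Squaring loses the sign, but the strict test already excludes x = 0.
  have hx0 : 0 < x := by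
    rcases Nat.eq_zero_or_pos x with h0 | h0
    · rw [h0] at h
      simp at h
    · exact h0
  have hx0' : (0 : ℝ) < x := by exact_mod_cast hx0
  refine softThreshold_beatsQAOA (thresholdRule_mem _) (by rw [himp]; positivity) ?_
  have h' : (N : ℝ) ^ N * 16 ^ N < 4 * (x : ℝ) ^ 2 * (N + 1 : ℝ) ^ (N + 1) := by exact_mod_cast h
  have h16 : ((2 : ℝ) ^ (2 * N)) ^ 2 = 16 ^ N := by
    rw [← pow_mul, mul_comm 2 N, mul_assoc, mul_comm N, pow_mul]
    norm_num
  rw [himp, mul_pow, div_pow, h16, div_lt_iff₀ (by positivity)]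
  have : (2 : ℝ) ^ 2 * ((x : ℝ) ^ 2 / 16 ^ N) * (N + 1 : ℝ) ^ (N + 1) =
      4 * (x : ℝ) ^ 2 * (N + 1 : ℝ) ^ (N + 1) / 16 ^ N := by
    ring
  rw [this, lt_div_iff₀ (by positivity)]
  exact h'

/-- Tests `fuel` consecutive degrees from `N + 1` on, skipping the degrees 3, 4, 6, 11. The
threshold is chosen with `N - 2j` about `√(N / 2)`, and `c = N.choose j` is updated along the way. -/
def thresholdScan : ℕ → ℕ → ℕ → ℕ → Bool
  | 0, _, _, _ => true
  | fuel + 1, N, j, c =>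
    ((Nat.beq N 2 || Nat.beq N 3 || Nat.beq N 5 || Nat.beq N 10) || thresholdTest N j c) &&
      bif Nat.blt (2 * (j + 1)) (N + 1) && Nat.ble (N + 1) (2 * (N + 1 - 2 * (j + 1)) ^ 2) then
        evalThen (c * (N + 1) / (j + 1)) fun c' => evalThen (N + 1) fun N' =>
          evalThen (j + 1) fun j' => thresholdScan fuel N' j' c'
      else
        evalThen (c * (N + 1) / (N + 1 - j)) fun c' => evalThen (N + 1) fun N' =>
          thresholdScan fuel N' j c'

/-- The invariant of the scan is that 2j ≤ N and its last argument is `N.choose j`. Both branches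
preserve it, as the divisions are exact. -/
theorem exists_of_thresholdScan {fuel N j : ℕ} (hj : 2 * j ≤ N)
    (h : thresholdScan fuel N j (N.choose j) = true) {M : ℕ} (hM : N ≤ M) (hM' : M < N + fuel)
    (hM2 : M ∉ ({2, 3, 5, 10} : Finset ℕ)) :
    ∃ i, 2 * i ≤ M ∧ thresholdTest M i (M.choose i) = true := by
  induction fuel generalizing N j with
  | zero => omega
  | succ fuel ih =>
    rw [thresholdScan, Bool.and_eq_true] at h
    obtain ⟨htest, hrest⟩ := h
    rcases hM.eq_or_lt with rfl | hlt
    · refine ⟨j, hj, ?_⟩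
      simp only [Finset.mem_insert, Finset.mem_singleton, not_or] at hM2
      simpa [hM2] using htest
    · simp only [evalThen_eq] at hrest
      rw [Bool.cond_eq_ite] at hrest
      split_ifs at hrest with hc
      · rw [Bool.and_eq_true, Nat.blt_eq] at hc
        have hch : N.choose j * (N + 1) / (j + 1) = (N + 1).choose (j + 1) := by
          rw [mul_comm, Nat.add_one_mul_choose_eq, Nat.mul_div_cancel _ (Nat.succ_pos j)]
        rw [hch] at hrest
        exact ih (by omega) hrest (by omega) (by omega)
      · have hch : N.choose j * (N + 1) / (N + 1 - j) = (N + 1).choose j := by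
          rw [Nat.choose_mul_succ_eq, Nat.mul_div_cancel _ (by omega)]
        rw [hch] at hrest
        exact ih (by omega) hrest (by omega) (by omega)

-- The scan starts at degree 3, with N = 2, j = 0 and binomial coefficient 1; its 998 steps end with
-- degree 1000.
theorem thresholdScan_thousand : thresholdScan 998 2 0 1 = true := by decide +kernel

theorem exists_threshold_beatsQAOA {D : ℕ} (h3 : 3 ≤ D) (hD : D ≤ 1000)
    (hD' : D ∉ ({3, 4, 6, 11} : Set ℕ)) : ∃ τ : ℕ, BeatsQAOA.{u} (thresholdAlgorithm τ) D := by
  obtain ⟨M, rfl⟩ : ∃ M, D = M + 1 := ⟨D - 1, by omega⟩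
  simp only [Set.mem_insert_iff, Set.mem_singleton_iff, not_or] at hD'
  obtain ⟨i, hi, hi'⟩ := exists_of_thresholdScan (N := 2) (j := 0) (by norm_num)
    thresholdScan_thousand (M := M) (by omega) (by omega) (by
      simp only [Finset.mem_insert, Finset.mem_singleton, not_or]
      omega)
  exact ⟨_, beatsQAOA_of_thresholdTest hi hi'⟩

end

theorem mainTheorem4 :
    -- the optimum over both angles of the one-step QAOA is `qaoaValue D`
    (∀ D : ℕ, 1 ≤ D → ForAllTriangleFreeRegular.{u} D fun _ _ _ G _ =>
      IsGreatest (Set.range fun p : ℝ × ℝ => qaoaCutFraction G p.1 p.2) (qaoaValue D)) ∧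
    -- the exact binomial formula for every soft-threshold rule
    (∀ D : ℕ, 1 ≤ D → ∀ (q : ℕ → ℝ) (hq : ∀ m, q m ∈ Set.Icc (-1 : ℝ) 1),
      ForAllTriangleFreeRegular.{u} D fun _ _ _ G _ =>
        (softThreshold q hq).expectedCutFraction G = 1 / 2 + softThresholdImprovement D q) ∧
    -- the threshold algorithm beats the QAOA for `3 ≤ D ≤ 1000` except `D = 3, 4, 6, 11`
    (∀ D : ℕ, 3 ≤ D → D ≤ 1000 → D ∉ ({3, 4, 6, 11} : Set ℕ) →
      ∃ τ : ℕ, BeatsQAOA.{u} (thresholdAlgorithm τ) D) ∧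
    -- for `D = 3, 4, 6, 11` the QAOA beats the threshold algorithm with any threshold
    (∀ D ∈ ({3, 4, 6, 11} : Set ℕ), ∀ τ : ℕ, ForAllTriangleFreeRegular.{u} D fun _ _ _ G _ =>
      (thresholdAlgorithm τ).expectedCutFraction G < qaoaValue D) ∧
    -- for `D = 2` the best threshold algorithm and the QAOA perform equally well
    ((∃ τ : ℕ, ForAllTriangleFreeRegular.{u} 2 fun _ _ _ G _ =>
        (thresholdAlgorithm τ).expectedCutFraction G = qaoaValue 2) ∧
      ∀ τ : ℕ, ForAllTriangleFreeRegular.{u} 2 fun _ _ _ G _ =>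
        (thresholdAlgorithm τ).expectedCutFraction G ≤ qaoaValue 2) ∧
    -- the soft-threshold rules for `D = 6` and `D = 11`
    BeatsQAOA.{u} (softThreshold softRuleSix softRuleSix_mem) 6 ∧
    BeatsQAOA.{u} (softThreshold softRuleEleven softRuleEleven_mem) 11 ∧
    -- the discrete-valued tensor algorithm, with `c = 0.599`, for `D = 3` and `D = 4`
    BeatsQAOA.{u} (fourValuedTensor (599 / 1000)).toLocal 3 ∧
    BeatsQAOA.{u} (fourValuedTensor (599 / 1000)).toLocal 4 ∧
    -- hence for all `3 ≤ D ≤ 1000` some one-step local tensor algorithm beats the one-step QAOA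
    (∀ D : ℕ, 3 ≤ D → D ≤ 1000 → ∃ T : TensorAlgorithm, BeatsQAOA.{u} T.toLocal D) := by

  refine ⟨fun D hD V _ _ _ G _ htri hreg => isGreatest_qaoa hD G htri hreg,
    fun D hD q hq V _ _ _ G _ htri hreg =>
      softThreshold_expectedCutFraction q hq hD G htri hreg,
    fun D h3 hD hD' => exists_threshold_beatsQAOA h3 hD hD',
    fun D hD τ => threshold_lt_qaoaValue hD τ,
    ⟨⟨2, threshold_two_eq_qaoaValue⟩, threshold_two_le_qaoaValue⟩,
    softRuleSix_beatsQAOA, softRuleEleven_beatsQAOA, fourValuedTensor_beatsQAOA_three,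
    fourValuedTensor_beatsQAOA_four, fun D h3 hD => ?_⟩
  by_cases hD' : D ∈ ({3, 4, 6, 11} : Set ℕ)
  · rcases hD' with rfl | rfl | rfl | rfl
    · exact ⟨_, fourValuedTensor_beatsQAOA_three⟩
    · exact ⟨_, fourValuedTensor_beatsQAOA_four⟩
    · exact softRuleSix_beatsQAOA.exists_tensor (by norm_num)
    · exact softRuleEleven_beatsQAOA.exists_tensor (by norm_num)
  · obtain ⟨τ, hτ⟩ := exists_threshold_beatsQAOA h3 hD hD'
    exact BeatsQAOA.exists_tensor (by omega) hτ
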